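/- For $\beta>0$ let $K_\beta$ be the Klein bottle obtained as the quotient of $\mathbb{C}=\mathbb{R}^2$ by the group generated by $\sigma:z\mapsto\bar z+\pi$ and $t:z\mapsto z+2i\beta$, and let $g_\beta$ be the flat metric it inherits. "Riemannian metric" means a continuous field of inner products. For such a metric $g$ on $K_\beta$ let $l_\sigma(g)$, $l_v(g)$, $l_h(g)$ be the least lengths (infima over rectifiable closed curves) of curves freely homotopic, respectively, to a loop closed by a glide reflection of horizontal displacement $\pi$ (that is, by $\sigma$ or by $t\sigma$), to a loop closed by the vertical translation $t$, and to a loop closed by the horizontal translation $\sigma^2$. Put $L_\sigma(g)=\min\{l_\sigma(g),l_h(g)\}$. **Theorem.** Let $\beta>0$. 1. If $\beta\le 2\ln(2+\sqrt3)$, then every Riemannian metric $g$ on $K_\beta$ conformal to $g_\beta$ satisfies $$L_\sigma(g)\,l_v(g)\le\frac{\arcsin\left(\frac{e^{\beta}-1}{e^{\beta}+1}\right)}{\frac{e^{\beta}-1}{e^{\beta}+1}}\,\mathrm{vol}(g).$$ Equality holds for some metric conformal to $g_\beta$ that is isometric to the spherical metric $f(v)^2du^2+dv^2$ on the quotient of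 the $(u,v)$-plane by $(u,v)\mapsto(u+\pi,-v)$ and $(u,v)\mapsto(u,v+4b)$, where $b\in(0,\pi/2)$ satisfies $\beta=2\ln\tan\left(\frac{\pi}{4}+\frac b2\right)$ and $f$ is the $2b$-periodic function equal to $\cos v$ for $|v|\le b$. 2. If $\beta>2\ln(2+\sqrt3)$, then every Riemannian metric $g$ on $K_\beta$ conformal to $g_\beta$ satisfies $$L_\sigma(g)\,l_v(g)\le\frac23\cdot\frac{3\beta+4\pi-6\ln(2+\sqrt3)}{4\sqrt3+\beta-2\ln(2+\sqrt3)}\,\mathrm{vol}(g).$$ Equality holds for some metric conformal to $g_\beta$ that is isometric to the flat-spherical metric $f(v)^2du^2+dv^2$ on the same quotient of the $(u,v)$-plane, where $b>\pi/3$ satisfies $\beta=2\ln(2+\sqrt3)+4\left(b-\frac\pi3\right)$ and $f$ is the $2b$-periodic function equal to $\cos v$ for $|v|\le\frac\pi3$ and to $\frac12$ for $\frac\pi3\le|v|\le b$. -/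

import Mathlib

namespace KleinBottle

noncomputable section

/-- The glide reflection `σ : z ↦ conj z + π` of the plane. -/
def glide (z : ℂ) : ℂ := (starRingEnd ℂ) z + (Real.pi : ℂ)

/-- The vertical translation `t : z ↦ z + 2iβ` of the plane. -/
def vert (β : ℝ) (z : ℂ) : ℂ := z + 2 * Complex.I * (β : ℂ)

/-- A (continuous) Riemannian metric on the Klein bottle `K`, the quotient of the plane by the
group generated by `glide` and `vert β`: a continuous field of inner products on the plane that is
invariant under both generators. The differential of `glide` is complex conjugation, that of
`vert β` is the identity. -/
structure Metric (β : ℝ) where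
  form : ℂ → LinearMap.BilinForm ℝ ℂ
  symm : ∀ z v w, form z v w = form z w v
  pos : ∀ z v, v ≠ 0 → 0 < form z v v
  continuous : ∀ v w, Continuous fun z => form z v w
  glide_invariant : ∀ z v w,
    form (glide z) ((starRingEnd ℂ) v) ((starRingEnd ℂ) w) = form z v w
  vert_invariant : ∀ z v w, form (vert β z) v w = form z v w

/-- The bilinear form `c² du² + dv²` on the tangent plane, with coordinates `u + iv`. -/
def warpedForm (c : ℝ) : LinearMap.BilinForm ℝ ℂ :=
  LinearMap.mk₂ ℝ (fun v w : ℂ => c ^ 2 * (v.re * w.re) + v.im * w.im)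
    (by intro a b c; simp; ring) (by intro a b c; simp; ring)
    (by intro a b c; simp; ring) (by intro a b c; simp; ring)

theorem warpedForm_apply (c : ℝ) (v w : ℂ) :
    warpedForm c v w = c ^ 2 * (v.re * w.re) + v.im * w.im := rfl

/-- The metric `f(v)² du² + dv²`, for `f` continuous, positive, even and `2β`-periodic, on the
quotient of the `(u, v)`-plane by `(u, v) ↦ (u + π, -v)` and `(u, v) ↦ (u, v + 2β)`. -/
def warped (β : ℝ) (f : ℝ → ℝ) (hc : Continuous f) (hpos : ∀ v, 0 < f v)
    (heven : ∀ v, f (-v) = f v) (hper : ∀ v, f (v + 2 * β) = f v) : Metric β where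
  form z := warpedForm (f z.im)
  symm z v w := by simp only [warpedForm_apply]; ring
  pos z v hv := by
    simp only [warpedForm_apply]
    have h := hpos z.im
    by_cases h0 : v.re = 0
    · have h1 : v.im ≠ 0 := fun h1 => hv (Complex.ext h0 h1)
      have := mul_self_pos.2 h1
      rw [h0]; linarith
    · have := mul_pos (pow_pos h 2) (mul_self_pos.2 h0)
      have := mul_self_nonneg v.im
      linarith
  continuous v w := by
    simp only [warpedForm_apply]
    fun_prop
  glide_invariant z v w := by
    simp [warpedForm_apply, glide, heven]
  vert_invariant z v w := by
    have : (vert β z).im = z.im + 2 * β := by simp [vert]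
    simp only [warpedForm_apply, this, hper]

/-- The flat metric `g_β`. -/
def flat (β : ℝ) : Metric β :=
  warped β (fun _ => 1) continuous_const (fun _ => one_pos) (fun _ => rfl) (fun _ => rfl)

/-- Distance from `v` to the nearest element of `2bℤ`
(Mathlib's quotient norm on the circle `ℝ / 2bℤ`). -/
def latticeDist (b v : ℝ) : ℝ := ‖(v : AddCircle (2 * b))‖

theorem latticeDist_continuous (b : ℝ) : Continuous (latticeDist b) :=
  (AddCircle.continuous_mk' (2 * b)).norm

theorem latticeDist_neg (b v : ℝ) : latticeDist b (-v) = latticeDist b v := by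
  simp [latticeDist]

theorem latticeDist_add (b v : ℝ) : latticeDist b (v + 2 * (2 * b)) = latticeDist b v := by
  have h : ((v + 2 * (2 * b) : ℝ) : AddCircle (2 * b)) = (v : AddCircle (2 * b)) := by
    rw [two_mul (2 * b), ← add_assoc, AddCircle.coe_add_period, AddCircle.coe_add_period]
  simp only [latticeDist, h]

theorem latticeDist_nonneg (b v : ℝ) : 0 ≤ latticeDist b v := norm_nonneg _

theorem latticeDist_le {b : ℝ} (hb : 0 < b) (v : ℝ) : latticeDist b v ≤ b := by
  have h := AddCircle.norm_le_half_period (2 * b) (x := (v : AddCircle (2 * b))) (by positivity)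
  rw [abs_of_pos (by positivity)] at h
  unfold latticeDist
  linarith

/-- The spherical metric `f(v)² du² + dv²`, `|u| ≤ π/2`, `|v| ≤ 2b`, where `f = cos` on
`|v| ≤ b` and `f` is `2b`-periodic. It has curvature one off the lines `v ∈ b + 2bℤ`. -/
def spherical (b : ℝ) (h0 : 0 < b) (h1 : b < Real.pi / 2) : Metric (2 * b) :=
  warped (2 * b) (fun v => Real.cos (latticeDist b v))
    (Real.continuous_cos.comp (latticeDist_continuous b))
    (fun v => Real.cos_pos_of_mem_Ioo
      ⟨by linarith [latticeDist_nonneg b v, Real.pi_pos], by linarith [latticeDist_le h0 v]⟩)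
    (fun v => by rw [latticeDist_neg])
    (fun v => by rw [latticeDist_add])

/-- The `2b`-periodic profile equal to `cos` on `|v| ≤ π/3` and to `1/2` on `π/3 ≤ |v| ≤ b`. -/
def flatSphericalProfile (b v : ℝ) : ℝ :=
  if latticeDist b v ≤ Real.pi / 3 then Real.cos (latticeDist b v) else 1 / 2

theorem flatSphericalProfile_eq (b v : ℝ) :
    flatSphericalProfile b v = Real.cos (min (latticeDist b v) (Real.pi / 3)) := by
  unfold flatSphericalProfile
  split_ifs with h
  · rw [min_eq_left h]
  · rw [min_eq_right (not_le.1 h).le, Real.cos_pi_div_three]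

theorem flatSphericalProfile_continuous (b : ℝ) : Continuous (flatSphericalProfile b) := by
  have h : flatSphericalProfile b =
      fun v => Real.cos (min (latticeDist b v) (Real.pi / 3)) :=
    funext (flatSphericalProfile_eq b)
  rw [h]
  exact Real.continuous_cos.comp ((latticeDist_continuous b).min continuous_const)

theorem flatSphericalProfile_pos (b v : ℝ) : 0 < flatSphericalProfile b v := by
  rw [flatSphericalProfile_eq]
  have hp := Real.pi_pos
  have h0 : 0 ≤ min (latticeDist b v) (Real.pi / 3) :=
    le_min (latticeDist_nonneg b v) (by positivity)
  have h1 := min_le_right (latticeDist b v) (Real.pi / 3)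
  exact Real.cos_pos_of_mem_Ioo ⟨by linarith, by linarith⟩

/-- The flat-spherical metric `f(v)² du² + dv²`, `|u| ≤ π/2`, `|v| ≤ 2b`, with
`f = flatSphericalProfile b`: round spherical caps `|v| ≤ π/3`, `2b - π/3 ≤ |v| ≤ 2b`, joined by
flat cylinders. -/
def flatSpherical (b : ℝ) : Metric (2 * b) :=
  warped (2 * b) (flatSphericalProfile b) (flatSphericalProfile_continuous b)
    (flatSphericalProfile_pos b)
    (fun v => by unfold flatSphericalProfile; rw [latticeDist_neg])
    (fun v => by unfold flatSphericalProfile; rw [latticeDist_add])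

namespace Metric

variable {β : ℝ}

/-- `g` is conformal to the flat metric `g_β`. -/
def IsConformal (g : Metric β) : Prop :=
  ∃ φ : ℂ → ℝ, (∀ z, 0 < φ z) ∧ ∀ z v w, g.form z v w = φ z * (flat β).form z v w

/-- The length of the (Lipschitz) curve `γ : [0, 1] → ℂ` for the metric `g`. -/
def length (g : Metric β) (γ : ℝ → ℂ) : ℝ :=
  ∫ s in (0 : ℝ)..1, Real.sqrt (g.form (γ s) (deriv γ s) (deriv γ s))

/-- The infimum of the lengths of the closed curves in the free homotopy class of the deck
transformation `τ`. A rectifiable closed curve of the quotient, in Lipschitz parametrization,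
belongs to this class exactly if it has a lift to the plane that joins some point `p` to `τ p`. -/
def leastLength (g : Metric β) (τ : ℂ → ℂ) : ℝ :=
  sInf {l : ℝ | ∃ γ : ℝ → ℂ, (∃ C, LipschitzOnWith C γ (Set.Icc 0 1)) ∧
    γ 1 = τ (γ 0) ∧ l = g.length γ}

/-- `l_σ`: least length of a curve closed by a glide reflection of horizontal displacement `π`.
These glide reflections are the `t^k σ`; they (together with their inverses, which are the same
curves with reversed orientation) form two classes, those of `σ` (axes `Im z ∈ 2βℤ`) and of `t σ`
(axes `Im z ∈ β + 2βℤ`). -/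
def lSigma (g : Metric β) : ℝ :=
  min (g.leastLength glide) (g.leastLength (vert β ∘ glide))

/-- `l_v`: least length in the class of the vertical translation `t`. -/
def lV (g : Metric β) : ℝ := g.leastLength (vert β)

/-- `l_h`: least length in the class of the horizontal translation `σ²`. -/
def lH (g : Metric β) : ℝ := g.leastLength (glide ∘ glide)

/-- `L_σ = min (l_σ, l_h)`. -/
def LSigma (g : Metric β) : ℝ := min g.lSigma g.lH

/-- The volume of the Klein bottle, computed on the fundamental domain `[0, π) × [0, 2β)`. -/
def vol (g : Metric β) : ℝ :=
  ∫ z in Set.Ico 0 Real.pi ×ℂ Set.Ico 0 (2 * β),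
    Real.sqrt (g.form z 1 1 * g.form z Complex.I Complex.I - g.form z 1 Complex.I ^ 2)

/-- `F` induces a `C¹` isometry between the Klein bottles with metrics `g` and `h`: it is a
`C¹` diffeomorphism of the plane, equivariant for the generators of the two groups, and the
pull-back of `h` is `g`. -/
def IsIsometry {β' : ℝ} (g : Metric β) (h : Metric β') (F : ℂ ≃ₜ ℂ) : Prop :=
  ContDiff ℝ 1 F ∧ ContDiff ℝ 1 F.symm ∧
  (∀ z, F (glide z) = glide (F z)) ∧ (∀ z, F (vert β z) = vert β' (F z)) ∧
  ∀ z v w, h.form (F z) (fderiv ℝ F z v) (fderiv ℝ F z w) = g.form z v w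

/-- The Klein bottles with metrics `g` and `h` are isometric. -/
def Isometric {β' : ℝ} (g : Metric β) (h : Metric β') : Prop :=
  ∃ F : ℂ ≃ₜ ℂ, g.IsIsometry h F

end Metric

/-- The constant for conformal types `β ≤ 2 ln (2 + √3)`. -/
def sphericalConst (β : ℝ) : ℝ :=
  Real.arcsin ((Real.exp β - 1) / (Real.exp β + 1)) / ((Real.exp β - 1) / (Real.exp β + 1))

/-- The constant for conformal types `β > 2 ln (2 + √3)`. -/
def flatSphericalConst (β : ℝ) : ℝ :=
  2 / 3 * ((3 * β + 4 * Real.pi - 6 * Real.log (2 + Real.sqrt 3)) /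
    (4 * Real.sqrt 3 + β - 2 * Real.log (2 + Real.sqrt 3)))

end

end KleinBottle

/-!
Replace the density of a conformal metric by its average over the horizontal lines at heights `y`
and `y + β`. The vertical lines, the horizontal lines and the great semicircles
`sinh y = t sin u` around the axes of `σ` and `tσ` then bound `l_v` and `L_σ` by integrals of this
average. A measure on the great circles `0 < t < sinh a`, computed once in polar and once in
Cartesian coordinates, shows that a suitable superposition of them, completed by the horizontal
lines of a flat band and by vertical lines, has the conformal factor of the extremal metric as its
total weight. The inequality follows by Cauchy–Schwarz and AM-GM.

For the extremal metric the least lengths are bounded from below by functions whose slope is at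
most the density: the distance from the equator for `l_v`, a multiple of `x` for `l_h`, and for
`l_σ` the spherical angle to a fixed point, after folding the plane onto a strip on which the
glide reflection is the antipodal map of the round sphere.
-/

namespace KleinBottle

noncomputable section

open MeasureTheory Set Filter Topology

/-! ### Real analysis -/

theorem lintegral_ofReal_of_hasDerivAt {G g : ℝ → ℝ} {a b : ℝ} (hab : a ≤ b)
    (hc : ContinuousOn G (Icc a b)) (hd : ∀ x ∈ Ioo a b, HasDerivAt G (g x) x)
    (h0 : ∀ x ∈ Ioo a b, 0 ≤ g x) :
    ∫⁻ x in Ioo a b, ENNReal.ofReal (g x) = ENNReal.ofReal (G b - G a) := by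
  have hi := intervalIntegral.integrableOn_deriv_of_nonneg hc hd h0
  have hi' : IntegrableOn g (Ioo a b) := hi.mono_set Ioo_subset_Ioc_self
  rw [← ofReal_integral_eq_lintegral_ofReal hi'
    ((ae_restrict_iff' measurableSet_Ioo).2 (Eventually.of_forall h0)),
    ← integral_Ioc_eq_integral_Ioo, ← intervalIntegral.integral_of_le hab,
    intervalIntegral.integral_eq_sub_of_hasDerivAt_of_le hab hc hd
      ((intervalIntegrable_iff_integrableOn_Ioc_of_le hab).2 hi)]

theorem hasDerivAt_sqrt_add_sq {c y : ℝ} (h : 0 < c + y ^ 2) :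
    HasDerivAt (fun y => √(c + y ^ 2)) (y / √(c + y ^ 2)) y := by
  refine (((hasDerivAt_pow 2 y).const_add c).sqrt h.ne').congr_deriv ?_
  field_simp
  simp

theorem hasDerivAt_sqrt_sub_sq {c y : ℝ} (h : 0 < c - y ^ 2) :
    HasDerivAt (fun y => √(c - y ^ 2)) (-y / √(c - y ^ 2)) y := by
  refine (((hasDerivAt_pow 2 y).const_sub c).sqrt h.ne').congr_deriv ?_
  field_simp
  simp

theorem hasDerivAt_arcsin_of_one_sub_sq_eq {q r : ℝ} (hr : 0 < r) (h : 1 - q ^ 2 = r ^ 2) :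
    HasDerivAt Real.arcsin (1 / r) q := by
  have hd := Real.hasDerivAt_arcsin (x := q) (by rintro rfl; nlinarith) (by rintro rfl; nlinarith)
  rwa [h, Real.sqrt_sq hr.le] at hd

theorem hasDerivAt_arcsin_div {A y : ℝ} (hA : 0 < A) (hy : y ^ 2 < A ^ 2) :
    HasDerivAt (fun y => Real.arcsin (y / A)) (1 / √(A ^ 2 - y ^ 2)) y := by
  have hs : 0 < √(A ^ 2 - y ^ 2) := Real.sqrt_pos.2 (sub_pos.2 hy)
  have hq : 1 - (y / A) ^ 2 = (√(A ^ 2 - y ^ 2) / A) ^ 2 := by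
    rw [div_pow, div_pow, Real.sq_sqrt (sub_nonneg.2 hy.le)]
    field_simp
  refine ((hasDerivAt_arcsin_of_one_sub_sq_eq (div_pos hs hA) hq).comp y
    ((hasDerivAt_id y).div_const A)).congr_deriv ?_
  field_simp

theorem hasDerivAt_arcsin_mul_div_sqrt {A E y : ℝ} (hA : 0 < A) (hE : 0 < E)
    (hy : y ^ 2 < A ^ 2) :
    HasDerivAt (fun y => Real.arcsin (y * √(E ^ 2 + A ^ 2) / (A * √(E ^ 2 + y ^ 2))))
      (E * √(E ^ 2 + A ^ 2) / ((E ^ 2 + y ^ 2) * √(A ^ 2 - y ^ 2))) y := by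
  have hs2 : √(A ^ 2 - y ^ 2) ^ 2 = A ^ 2 - y ^ 2 := Real.sq_sqrt (sub_nonneg.2 hy.le)
  have hS2 : √(E ^ 2 + y ^ 2) ^ 2 = E ^ 2 + y ^ 2 := Real.sq_sqrt (by positivity)
  have hH2 : √(E ^ 2 + A ^ 2) ^ 2 = E ^ 2 + A ^ 2 := Real.sq_sqrt (by positivity)
  have dS : HasDerivAt (fun y => √(E ^ 2 + y ^ 2)) (y / √(E ^ 2 + y ^ 2)) y :=
    hasDerivAt_sqrt_add_sq (by positivity)
  have hs : 0 < √(A ^ 2 - y ^ 2) := Real.sqrt_pos.2 (sub_pos.2 hy)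
  have hS : 0 < √(E ^ 2 + y ^ 2) := by positivity
  set s := √(A ^ 2 - y ^ 2)
  set H := √(E ^ 2 + A ^ 2)
  have dq : HasDerivAt (fun y => y * H / (A * √(E ^ 2 + y ^ 2)))
      (H * E ^ 2 / (A * √(E ^ 2 + y ^ 2) ^ 3)) y := by
    refine (((hasDerivAt_id y).mul_const H).fun_div (dS.const_mul A)
      (by positivity)).congr_deriv ?_
    simp only [id]
    field_simp
    rw [hS2]
    ring
  set S := √(E ^ 2 + y ^ 2)
  have hq : 1 - (y * H / (A * S)) ^ 2 = (E * s / (A * S)) ^ 2 := by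
    field_simp
    rw [hS2, hs2, hH2]
    ring
  refine ((hasDerivAt_arcsin_of_one_sub_sq_eq (by positivity) hq).comp y dq).congr_deriv ?_
  rw [← hS2]
  field_simp

theorem hasDerivAt_arcsin_sqrt_div {τ t : ℝ} (ht : t ^ 2 < τ ^ 2) :
    HasDerivAt (fun t => Real.arcsin (√(1 + t ^ 2) / √(1 + τ ^ 2)))
      (t / (√(1 + t ^ 2) * √(τ ^ 2 - t ^ 2))) t := by
  have hs : 0 < √(τ ^ 2 - t ^ 2) := Real.sqrt_pos.2 (sub_pos.2 ht)
  have hq : 1 - (√(1 + t ^ 2) / √(1 + τ ^ 2)) ^ 2 = (√(τ ^ 2 - t ^ 2) / √(1 + τ ^ 2)) ^ 2 := by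
    rw [div_pow, div_pow, Real.sq_sqrt (by positivity), Real.sq_sqrt (by positivity),
      Real.sq_sqrt (sub_nonneg.2 ht.le)]
    field_simp
    ring
  refine ((hasDerivAt_arcsin_of_one_sub_sq_eq (by positivity) hq).comp t
    ((hasDerivAt_sqrt_add_sq (by positivity)).div_const _)).congr_deriv ?_
  field_simp

theorem hasDerivAt_sqrt_sub_sq_div_sqrt_add_sq {τ t : ℝ} (ht : t ^ 2 < τ ^ 2) :
    HasDerivAt (fun t => √(τ ^ 2 - t ^ 2) / √(1 + t ^ 2))
      (-(t * (1 + τ ^ 2)) / ((1 + t ^ 2) * √(1 + t ^ 2) * √(τ ^ 2 - t ^ 2))) t := by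
  have hs : 0 < √(τ ^ 2 - t ^ 2) := Real.sqrt_pos.2 (sub_pos.2 ht)
  have hs2 : √(τ ^ 2 - t ^ 2) ^ 2 = τ ^ 2 - t ^ 2 := Real.sq_sqrt (sub_nonneg.2 ht.le)
  have hS2 : √(1 + t ^ 2) ^ 2 = 1 + t ^ 2 := Real.sq_sqrt (by positivity)
  refine ((hasDerivAt_sqrt_sub_sq (sub_pos.2 ht)).fun_div
    (hasDerivAt_sqrt_add_sq (c := 1) (by positivity)) (by positivity)).congr_deriv ?_
  field_simp
  rw [hS2, hs2]
  ring

theorem lintegral_Ioo_chord {A E C : ℝ} (hA : 0 < A) (hE : 0 < E)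
    (hC : C ≤ 1 / √(E ^ 2 + A ^ 2)) :
    ∫⁻ y in Ioo (-A) A,
      ENNReal.ofReal ((√(E ^ 2 + A ^ 2) / (E ^ 2 + y ^ 2) - C) / √(A ^ 2 - y ^ 2)) =
    ENNReal.ofReal (Real.pi * (1 / E - C)) := by
  have hH : 0 < √(E ^ 2 + A ^ 2) := by positivity
  have key := lintegral_ofReal_of_hasDerivAt (a := -A) (b := A)
    (G := fun y => 1 / E * Real.arcsin (y * √(E ^ 2 + A ^ 2) / (A * √(E ^ 2 + y ^ 2))) -
      C * Real.arcsin (y / A))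
    (g := fun y => (√(E ^ 2 + A ^ 2) / (E ^ 2 + y ^ 2) - C) / √(A ^ 2 - y ^ 2))
    (by linarith) ?_ ?_ ?_
  · rw [key]
    congr 1
    have hratio : A * √(E ^ 2 + A ^ 2) / (A * √(E ^ 2 + A ^ 2)) = 1 := div_self (by positivity)
    simp only [neg_sq, neg_mul, neg_div, hratio, div_self hA.ne', Real.arcsin_neg, Real.arcsin_one]
    ring
  · have hratio_cont : Continuous fun y => y * √(E ^ 2 + A ^ 2) / (A * √(E ^ 2 + y ^ 2)) :=
      Continuous.div (by fun_prop) (by fun_prop) fun y => by positivity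
    exact ((continuous_const.mul (Real.continuous_arcsin.comp hratio_cont)).sub
      (continuous_const.mul (Real.continuous_arcsin.comp (by fun_prop)))).continuousOn
  · intro y hy
    have hyA : y ^ 2 < A ^ 2 := sq_lt_sq' hy.1 hy.2
    refine (((hasDerivAt_arcsin_mul_div_sqrt hA hE hyA).const_mul (1 / E)).sub
      ((hasDerivAt_arcsin_div hA hyA).const_mul C)).congr_deriv ?_
    field_simp
  · intro y hy
    have hyA : y ^ 2 < A ^ 2 := sq_lt_sq' hy.1 hy.2
    refine div_nonneg (sub_nonneg.2 (hC.trans ?_)) (Real.sqrt_nonneg _)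
    rw [div_le_div_iff₀ hH (by positivity), Real.mul_self_sqrt (by positivity)]
    linarith

theorem sq_integral_mul_le {f g : ℝ → ℝ} (hf : Continuous f) (hg : Continuous g)
    {a b : ℝ} (hab : a ≤ b) :
    (∫ y in a..b, f y * g y) ^ 2 ≤ (∫ y in a..b, f y ^ 2) * ∫ y in a..b, g y ^ 2 := by
  have hquad : ∀ c : ℝ, 0 ≤ (∫ y in a..b, g y ^ 2) * (c * c) +
      (-(2 * ∫ y in a..b, f y * g y)) * c + ∫ y in a..b, f y ^ 2 := fun c => by
    have hint : ∀ h : ℝ → ℝ, Continuous h → IntervalIntegrable h volume a b :=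
      fun h hh => hh.intervalIntegrable a b
    have hexp : ∫ y in a..b, (f y - c * g y) ^ 2 = (∫ y in a..b, g y ^ 2) * (c * c) +
        (-(2 * ∫ y in a..b, f y * g y)) * c + ∫ y in a..b, f y ^ 2 := by
      have : ∀ y, (f y - c * g y) ^ 2 = c * c * g y ^ 2 - 2 * c * (f y * g y) + f y ^ 2 :=
        fun y => by ring
      simp only [this]
      rw [intervalIntegral.integral_add (hint _ (by fun_prop)) (hint _ (by fun_prop)),
        intervalIntegral.integral_sub (hint _ (by fun_prop)) (hint _ (by fun_prop)),
        intervalIntegral.integral_const_mul, intervalIntegral.integral_const_mul]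
      ring
    rw [← hexp]
    exact intervalIntegral.integral_nonneg hab fun y _ => sq_nonneg _
  have := discrim_le_zero hquad
  rw [discrim] at this
  linarith

theorem intervalIntegral_swap_of_continuous {f : ℝ → ℝ → ℝ} (hf : Continuous (Function.uncurry f))
    (a b c d : ℝ) :
    ∫ x in a..b, ∫ y in c..d, f x y = ∫ y in c..d, ∫ x in a..b, f x y := by
  refine intervalIntegral_intervalIntegral_swap ?_
  exact (hf.continuousOn.integrableOn_compact (isCompact_uIcc.prod isCompact_uIcc)).mono_set
    (prod_mono uIoc_subset_uIcc uIoc_subset_uIcc)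

theorem integral_neg_self_of_even {f : ℝ → ℝ} (hf : Continuous f) (he : ∀ y, f (-y) = f y)
    (a : ℝ) : ∫ y in (-a)..a, f y = 2 * ∫ y in (0 : ℝ)..a, f y := by
  have h := intervalIntegral.integral_comp_neg (a := 0) (b := a) f
  simp only [he, neg_zero] at h
  rw [← intervalIntegral.integral_add_adjacent_intervals (hf.intervalIntegrable (-a) 0)
    (hf.intervalIntegrable _ _), ← h, two_mul]

theorem integral_eq_two_mul_half_of_symm {f : ℝ → ℝ} (hf : Continuous f) {b : ℝ}
    (hs : ∀ y, f (b - y) = f y) : ∫ y in (0 : ℝ)..b, f y = 2 * ∫ y in (0 : ℝ)..(b / 2), f y := by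
  have h := intervalIntegral.integral_comp_sub_left (a := 0) (b := b / 2) f b
  simp only [hs, sub_zero, sub_half] at h
  rw [← intervalIntegral.integral_add_adjacent_intervals (hf.intervalIntegrable 0 (b / 2))
    (hf.intervalIntegrable _ _), ← h, two_mul]

theorem integral_two_mul_eq_integral_add {f : ℝ → ℝ} (hf : Continuous f) (b : ℝ) :
    ∫ y in (0 : ℝ)..(2 * b), f y = ∫ y in (0 : ℝ)..b, (f y + f (y + b)) := by
  have h := intervalIntegral.integral_comp_add_right (a := 0) (b := b) f b
  rw [zero_add, ← two_mul] at h
  rw [intervalIntegral.integral_add (hf.intervalIntegrable _ _)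
    (Continuous.intervalIntegrable (by fun_prop) _ _), h,
    intervalIntegral.integral_add_adjacent_intervals (hf.intervalIntegrable _ _)
    (hf.intervalIntegrable _ _)]

/-! ### Averages over great circles -/

/-- The Euclidean speed, in Mercator coordinates `(u, y)`, of the great circle `sinh y = t sin u`
parametrized by the longitude `u`. -/
def greatCircleSpeed (t u : ℝ) : ℝ :=
  √(1 + t ^ 2) / √(1 + (t * Real.sin u) ^ 2)

theorem continuous_greatCircleSpeed (t : ℝ) : Continuous (greatCircleSpeed t) :=
  Continuous.div (by fun_prop) (by fun_prop) fun u => by positivity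

/-- The density, as a function of the squared radius `s`, of a measure on the disc of radius `τ`
that superposes the great circles `sinh y = t sin u`, `0 < t < τ`: in polar coordinates `(t, u)` it
is a mixture of these circles, while its marginal along the ordinate `sinh y` is explicit. -/
def zoneKernel (τ C s : ℝ) : ℝ :=
  (√(1 + τ ^ 2) / (1 + s) - C) / √(τ ^ 2 - s)

theorem zoneKernel_nonneg {τ C s : ℝ} (hC : C ≤ 1 / √(1 + τ ^ 2)) (hs0 : 0 ≤ s)
    (hs : s < τ ^ 2) : 0 ≤ zoneKernel τ C s := by
  refine div_nonneg (sub_nonneg.2 (hC.trans ?_)) (Real.sqrt_nonneg _)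
  rw [div_le_div_iff₀ (by positivity) (by positivity), Real.mul_self_sqrt (by positivity)]
  linarith

theorem one_div_sqrt_one_add_sq_sub_nonneg {τ C x : ℝ} (hC : C ≤ 1 / √(1 + τ ^ 2))
    (hx : x ^ 2 ≤ τ ^ 2) : 0 ≤ 1 / √(1 + x ^ 2) - C :=
  sub_nonneg.2 (hC.trans (one_div_le_one_div_of_le (by positivity)
    (Real.sqrt_le_sqrt (by linarith))))

theorem lintegral_zoneKernel_chord {τ C x : ℝ} (hC : C ≤ 1 / √(1 + τ ^ 2))
    (hx : x ^ 2 < τ ^ 2) :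
    ∫⁻ y in Ioo (-√(τ ^ 2 - x ^ 2)) (√(τ ^ 2 - x ^ 2)),
      ENNReal.ofReal (zoneKernel τ C (y ^ 2 + x ^ 2)) =
    ENNReal.ofReal (Real.pi * (1 / √(1 + x ^ 2) - C)) := by
  have hA2 : √(τ ^ 2 - x ^ 2) ^ 2 = τ ^ 2 - x ^ 2 := Real.sq_sqrt (sub_nonneg.2 hx.le)
  have hE2 : √(1 + x ^ 2) ^ 2 = 1 + x ^ 2 := Real.sq_sqrt (by positivity)
  have hH : √(1 + x ^ 2) ^ 2 + √(τ ^ 2 - x ^ 2) ^ 2 = 1 + τ ^ 2 := by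
    rw [hA2, hE2]
    ring
  rw [← lintegral_Ioo_chord (Real.sqrt_pos.2 (sub_pos.2 hx)) (by positivity) (by rwa [hH])]
  congr 1
  ext y
  rw [zoneKernel, hH, hA2, hE2, sub_sub, add_comm (y ^ 2), add_assoc]

theorem lintegral_zoneKernel_radial {τ C : ℝ} (hτ : 0 < τ) (hC : C ≤ 1 / √(1 + τ ^ 2)) :
    ∫⁻ t in Ioo 0 τ, ENNReal.ofReal (t * zoneKernel τ C (t ^ 2) / √(1 + t ^ 2)) =
    ENNReal.ofReal (τ / √(1 + τ ^ 2) - C * Real.arctan τ) := by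
  have hS : ∀ t : ℝ, √(1 + t ^ 2) ≠ 0 := fun t => by positivity
  have key := lintegral_ofReal_of_hasDerivAt (a := 0) (b := τ)
    (G := fun t => -(1 / √(1 + τ ^ 2)) * (√(τ ^ 2 - t ^ 2) / √(1 + t ^ 2)) -
      C * Real.arcsin (√(1 + t ^ 2) / √(1 + τ ^ 2)))
    (g := fun t => t * zoneKernel τ C (t ^ 2) / √(1 + t ^ 2)) hτ.le ?_ ?_ ?_
  · rw [key]
    congr 1
    have harcsin : Real.arcsin (1 / √(1 + τ ^ 2)) = Real.pi / 2 - Real.arctan τ := by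
      rw [Real.arctan_eq_arccos hτ.le, Real.arccos, one_div]
      ring
    simp only [sub_self, Real.sqrt_zero, zero_div, mul_zero, div_self (hS τ), Real.arcsin_one,
      ne_eq, OfNat.ofNat_ne_zero, not_false_eq_true, zero_pow, sub_zero, add_zero,
      Real.sqrt_one, div_one, harcsin, Real.sqrt_sq hτ.le]
    ring
  · have hquot : Continuous fun t => √(τ ^ 2 - t ^ 2) / √(1 + t ^ 2) :=
      Continuous.div (by fun_prop) (by fun_prop) hS
    exact ((continuous_const.mul hquot).sub
      (continuous_const.mul (Real.continuous_arcsin.comp (by fun_prop)))).continuousOn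
  · intro t ht
    have htτ : t ^ 2 < τ ^ 2 := pow_lt_pow_left₀ ht.2 ht.1.le two_ne_zero
    have hH2 : √(1 + τ ^ 2) ^ 2 = 1 + τ ^ 2 := Real.sq_sqrt (by positivity)
    have hs : 0 < √(τ ^ 2 - t ^ 2) := Real.sqrt_pos.2 (sub_pos.2 htτ)
    refine (((hasDerivAt_sqrt_sub_sq_div_sqrt_add_sq htτ).const_mul _).sub
      ((hasDerivAt_arcsin_sqrt_div htτ).const_mul C)).congr_deriv ?_
    rw [zoneKernel]
    field_simp
    linear_combination (-t) * hH2
  · intro t ht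
    have htτ : t ^ 2 < τ ^ 2 := pow_lt_pow_left₀ ht.2 ht.1.le two_ne_zero
    exact div_nonneg (mul_nonneg ht.1.le (zoneKernel_nonneg hC (sq_nonneg t) htτ))
      (Real.sqrt_nonneg _)

/-- The function `R` of the ordinate `sinh y`, relative to arclength on the sphere and weighted by
`zoneKernel`, on the disc of radius `τ`. -/
def zoneDensity (τ C : ℝ) (R : ℝ → ℝ) (p : ℝ × ℝ) : ENNReal :=
  if p.1 ^ 2 + p.2 ^ 2 < τ ^ 2 then
    ENNReal.ofReal (R p.2 / √(1 + p.2 ^ 2)) * ENNReal.ofReal (zoneKernel τ C (p.1 ^ 2 + p.2 ^ 2))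
  else 0

section ZoneDensity

variable {τ C L : ℝ} {R : ℝ → ℝ}

theorem measurable_zoneDensity (hR : Continuous R) : Measurable (zoneDensity τ C R) := by
  refine Measurable.ite (measurableSet_lt (by fun_prop) (by fun_prop)) ?_ measurable_const
  unfold zoneKernel
  fun_prop

theorem mul_le_lintegral_zoneDensity_circle (hC : C ≤ 1 / √(1 + τ ^ 2)) (hR : Continuous R)
    (hR0 : ∀ x, 0 ≤ R x) {t : ℝ} (ht : t ∈ Ioo 0 τ) (hL0 : 0 ≤ L)
    (hL : L ≤ ∫ u in (-Real.pi)..Real.pi,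
      R (t * Real.sin u) * greatCircleSpeed t u) :
    ENNReal.ofReal L * ENNReal.ofReal (t * zoneKernel τ C (t ^ 2) / √(1 + t ^ 2)) ≤
      ∫⁻ u in Ioo (-Real.pi) Real.pi,
        ENNReal.ofReal t • zoneDensity τ C R (polarCoord.symm (t, u)) := by
  have htτ : t ^ 2 < τ ^ 2 := pow_lt_pow_left₀ ht.2 ht.1.le two_ne_zero
  have hk : 0 ≤ t * zoneKernel τ C (t ^ 2) :=
    mul_nonneg ht.1.le (zoneKernel_nonneg hC (sq_nonneg t) htτ)
  have hcont : Continuous fun u => R (t * Real.sin u) / √(1 + (t * Real.sin u) ^ 2) :=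
    Continuous.div (by fun_prop) (by fun_prop) fun u => by positivity
  have hpolar : ∀ u, ENNReal.ofReal t • zoneDensity τ C R (polarCoord.symm (t, u)) =
      ENNReal.ofReal (t * zoneKernel τ C (t ^ 2)) *
        ENNReal.ofReal (R (t * Real.sin u) / √(1 + (t * Real.sin u) ^ 2)) := fun u => by
    have hsq : (t * Real.cos u) ^ 2 + (t * Real.sin u) ^ 2 = t ^ 2 := by
      rw [mul_pow, mul_pow, ← mul_add, Real.cos_sq_add_sin_sq, mul_one]
    simp only [zoneDensity, polarCoord_symm_apply, hsq, if_pos htτ, smul_eq_mul]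
    rw [ENNReal.ofReal_mul ht.1.le]
    ring
  have hmean : L / √(1 + t ^ 2) ≤ ∫ u in (-Real.pi)..Real.pi,
      R (t * Real.sin u) / √(1 + (t * Real.sin u) ^ 2) := by
    rw [div_le_iff₀ (by positivity), ← intervalIntegral.integral_mul_const]
    refine hL.trans_eq ?_
    congr 1
    ext u
    rw [greatCircleSpeed]
    ring
  simp only [hpolar]
  rw [lintegral_const_mul' _ _ ENNReal.ofReal_ne_top, ← ofReal_integral_eq_lintegral_ofReal
      (hcont.integrableOn_Icc.mono_set Ioo_subset_Icc_self)
      (Eventually.of_forall fun u => div_nonneg (hR0 _) (Real.sqrt_nonneg _)),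
    ← ENNReal.ofReal_mul hL0, ← ENNReal.ofReal_mul hk, ← integral_Ioc_eq_integral_Ioo,
    ← intervalIntegral.integral_of_le (by linarith [Real.pi_pos])]
  refine ENNReal.ofReal_le_ofReal (Eq.trans_le ?_ (mul_le_mul_of_nonneg_left hmean hk))
  ring

theorem mul_le_lintegral_zoneDensity (hτ : 0 < τ) (hC : C ≤ 1 / √(1 + τ ^ 2))
    (hR : Continuous R) (hR0 : ∀ x, 0 ≤ R x) (hL0 : 0 ≤ L)
    (hL : ∀ t ∈ Ioo 0 τ, L ≤ ∫ u in (-Real.pi)..Real.pi,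
      R (t * Real.sin u) * greatCircleSpeed t u) :
    ENNReal.ofReal (L * (τ / √(1 + τ ^ 2) - C * Real.arctan τ)) ≤
      ∫⁻ p, zoneDensity τ C R p := by
  have hmeas : Measurable fun p : ℝ × ℝ =>
      ENNReal.ofReal p.1 • zoneDensity τ C R (polarCoord.symm p) :=
    Measurable.mul (by fun_prop)
      ((measurable_zoneDensity hR).comp continuous_polarCoord_symm.measurable)
  rw [← lintegral_comp_polarCoord_symm, polarCoord_target, Measure.volume_eq_prod,
    ← Measure.prod_restrict, lintegral_prod _ hmeas.aemeasurable,
    ENNReal.ofReal_mul hL0, ← lintegral_zoneKernel_radial hτ hC,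
    ← lintegral_const_mul' _ _ ENNReal.ofReal_ne_top]
  exact (setLIntegral_mono' measurableSet_Ioo fun t ht =>
    mul_le_lintegral_zoneDensity_circle hC hR hR0 ht hL0 (hL t ht)).trans
      (lintegral_mono_set Ioo_subset_Ioi_self)

theorem lintegral_zoneDensity_chord (hτ : 0 < τ) (hC : C ≤ 1 / √(1 + τ ^ 2))
    (hR0 : ∀ x, 0 ≤ R x) (x : ℝ) :
    ∫⁻ y, zoneDensity τ C R (y, x) = (Ioo (-τ) τ).indicator (fun x =>
      ENNReal.ofReal (R x / √(1 + x ^ 2) * (Real.pi * (1 / √(1 + x ^ 2) - C)))) x := by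
  by_cases hx : x ∈ Ioo (-τ) τ
  · have hxτ : x ^ 2 < τ ^ 2 := sq_lt_sq' hx.1 hx.2
    rw [indicator_of_mem hx, ENNReal.ofReal_mul (div_nonneg (hR0 _) (Real.sqrt_nonneg _)),
      ← lintegral_zoneKernel_chord hC hxτ, ← lintegral_const_mul' _ _ ENNReal.ofReal_ne_top,
      ← lintegral_indicator measurableSet_Ioo]
    refine lintegral_congr fun y => ?_
    have hiff : y ∈ Ioo (-√(τ ^ 2 - x ^ 2)) (√(τ ^ 2 - x ^ 2)) ↔ y ^ 2 + x ^ 2 < τ ^ 2 := by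
      rw [mem_Ioo, ← abs_lt, Real.lt_sqrt (abs_nonneg _), sq_abs, lt_sub_iff_add_lt]
    by_cases hy : y ^ 2 + x ^ 2 < τ ^ 2
    · rw [indicator_of_mem (hiff.2 hy), zoneDensity, if_pos hy]
    · rw [indicator_of_notMem fun h => hy (hiff.1 h), zoneDensity, if_neg hy]
  · rw [indicator_of_notMem hx]
    refine (lintegral_congr fun y => if_neg fun h => hx ?_).trans lintegral_zero
    exact abs_lt.1 (abs_lt_of_sq_lt_sq (by nlinarith [sq_nonneg y]) hτ.le)

theorem lintegral_zoneDensity (hτ : 0 < τ) (hC : C ≤ 1 / √(1 + τ ^ 2)) (hR : Continuous R)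
    (hR0 : ∀ x, 0 ≤ R x) :
    ∫⁻ p, zoneDensity τ C R p = ENNReal.ofReal
      (Real.pi * ∫ x in (-τ)..τ, R x / √(1 + x ^ 2) * (1 / √(1 + x ^ 2) - C)) := by
  have hS : ∀ x : ℝ, √(1 + x ^ 2) ≠ 0 := fun x => by positivity
  have hcont : Continuous fun x => R x / √(1 + x ^ 2) * (Real.pi * (1 / √(1 + x ^ 2) - C)) :=
    (hR.div (by fun_prop) hS).mul (continuous_const.mul
      ((Continuous.div (by fun_prop) (by fun_prop) hS).sub continuous_const))
  have hpos : ∀ x ∈ Ioo (-τ) τ,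
      0 ≤ R x / √(1 + x ^ 2) * (Real.pi * (1 / √(1 + x ^ 2) - C)) := fun x hx =>
    mul_nonneg (div_nonneg (hR0 _) (Real.sqrt_nonneg _)) (mul_nonneg Real.pi_pos.le
      (one_div_sqrt_one_add_sq_sub_nonneg hC (sq_lt_sq' hx.1 hx.2).le))
  rw [Measure.volume_eq_prod, lintegral_prod_symm _ (measurable_zoneDensity hR).aemeasurable]
  simp only [lintegral_zoneDensity_chord hτ hC hR0]
  rw [lintegral_indicator measurableSet_Ioo, ← ofReal_integral_eq_lintegral_ofReal
      (hcont.integrableOn_Icc.mono_set Ioo_subset_Icc_self)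
      ((ae_restrict_iff' measurableSet_Ioo).2 (Eventually.of_forall hpos)),
    ← integral_Ioc_eq_integral_Ioo, ← intervalIntegral.integral_of_le (by linarith),
    ← intervalIntegral.integral_const_mul]
  congr 2
  ext x
  ring

theorem mul_le_integral_of_le_greatCircle (hτ : 0 < τ) (hC : C ≤ 1 / √(1 + τ ^ 2))
    (hR : Continuous R) (hR0 : ∀ x, 0 ≤ R x) (hL0 : 0 ≤ L)
    (hL : ∀ t ∈ Ioo 0 τ, L ≤ ∫ u in (-Real.pi)..Real.pi,
      R (t * Real.sin u) * greatCircleSpeed t u) :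
    L * (τ / √(1 + τ ^ 2) - C * Real.arctan τ) ≤
      Real.pi * ∫ x in (-τ)..τ, R x / √(1 + x ^ 2) * (1 / √(1 + x ^ 2) - C) := by
  refine (ENNReal.ofReal_le_ofReal_iff (mul_nonneg Real.pi_pos.le ?_)).1
    ((mul_le_lintegral_zoneDensity hτ hC hR hR0 hL0 hL).trans_eq
      (lintegral_zoneDensity hτ hC hR hR0))
  exact intervalIntegral.integral_nonneg (by linarith) fun x hx =>
    mul_nonneg (div_nonneg (hR0 _) (Real.sqrt_nonneg _))
      (one_div_sqrt_one_add_sq_sub_nonneg hC (sq_le_sq' hx.1 hx.2))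

end ZoneDensity

/-! ### Curves in a conformal metric -/

theorem continuous_complex_mk : Continuous fun p : ℝ × ℝ => (⟨p.1, p.2⟩ : ℂ) :=
  Complex.equivRealProdCLM.symm.continuous

theorem hasDerivAt_complex_mk {f g : ℝ → ℝ} {f' g' u : ℝ} (hf : HasDerivAt f f' u)
    (hg : HasDerivAt g g' u) :
    HasDerivAt (fun u => (⟨f u, g u⟩ : ℂ)) ⟨f', g'⟩ u :=
  Complex.equivRealProdCLM.symm.hasFDerivAt.comp_hasDerivAt u (hf.prodMk hg)

namespace Metric

variable {β : ℝ} {g : Metric β}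

/-- The length of the tangent vector `1`: for a conformal metric `g = ρ² g_β` this is `ρ`. -/
def density (g : Metric β) (z : ℂ) : ℝ := √(g.form z 1 1)

theorem density_pos (g : Metric β) (z : ℂ) : 0 < g.density z :=
  Real.sqrt_pos.2 (g.pos z 1 one_ne_zero)

theorem continuous_density (g : Metric β) : Continuous g.density :=
  (g.continuous 1 1).sqrt

theorem continuous_density_mk (g : Metric β) :
    Continuous (Function.uncurry fun x y : ℝ => g.density ⟨x, y⟩) :=
  g.continuous_density.comp continuous_complex_mk

theorem continuous_sq_density_mk (g : Metric β) :
    Continuous (Function.uncurry fun x y : ℝ => g.density ⟨x, y⟩ ^ 2) :=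
  g.continuous_density_mk.pow 2

theorem density_glide (g : Metric β) (x y : ℝ) :
    g.density ⟨x + Real.pi, -y⟩ = g.density ⟨x, y⟩ := by
  have h := g.glide_invariant ⟨x, y⟩ 1 1
  have e : glide ⟨x, y⟩ = ⟨x + Real.pi, -y⟩ := by
    apply Complex.ext <;> simp [glide]
  rw [e, map_one] at h
  rw [density, density, h]

theorem density_vert (g : Metric β) (x y : ℝ) :
    g.density ⟨x, y + 2 * β⟩ = g.density ⟨x, y⟩ := by
  have h := g.vert_invariant ⟨x, y⟩ 1 1
  have e : vert β ⟨x, y⟩ = ⟨x, y + 2 * β⟩ := by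
    apply Complex.ext <;> simp [vert]
  rw [e] at h
  rw [density, density, h]

theorem IsConformal.form_eq (hg : g.IsConformal) (z v w : ℂ) :
    g.form z v w = g.density z ^ 2 * (v.re * w.re + v.im * w.im) := by
  obtain ⟨φ, hφ, h⟩ := hg
  have hone : g.form z 1 1 = φ z := by
    rw [h]
    simp [flat, warped, warpedForm_apply]
  rw [density, hone, Real.sq_sqrt (hφ z).le, h]
  simp [flat, warped, warpedForm_apply]

theorem IsConformal.sqrt_form_self (hg : g.IsConformal) (z v : ℂ) :
    √(g.form z v v) = g.density z * ‖v‖ := by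
  rw [hg.form_eq, Real.sqrt_mul (by positivity), Real.sqrt_sq (g.density_pos z).le,
    Complex.norm_def, Complex.normSq_apply]

theorem IsConformal.length_eq (hg : g.IsConformal) (γ : ℝ → ℂ) :
    g.length γ = ∫ s in (0 : ℝ)..1, g.density (γ s) * ‖deriv γ s‖ := by
  simp only [length, hg.sqrt_form_self]

theorem IsConformal.vol_eq (hg : g.IsConformal) (hβ : 0 ≤ β) :
    g.vol = ∫ y in (0 : ℝ)..(2 * β), ∫ x in (0 : ℝ)..Real.pi, g.density ⟨x, y⟩ ^ 2 := by
  have harea : ∀ z, √(g.form z 1 1 * g.form z Complex.I Complex.I - g.form z 1 Complex.I ^ 2) =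
      g.density z ^ 2 := fun z => by
    simp only [hg.form_eq, Complex.one_re, Complex.one_im, Complex.I_re, Complex.I_im]
    refine Eq.trans ?_ (Real.sqrt_sq (sq_nonneg (g.density z)))
    congr 1
    ring
  have hc := g.continuous_sq_density_mk
  simp only [vol, harea]
  refine (Complex.volume_preserving_equiv_real_prod.setIntegral_preimage_emb
    Complex.measurableEquivRealProd.measurableEmbedding
    (fun p : ℝ × ℝ => g.density ⟨p.1, p.2⟩ ^ 2) (Ico 0 Real.pi ×ˢ Ico 0 (2 * β))).trans ?_
  rw [Measure.volume_eq_prod, setIntegral_prod]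
  · rw [← intervalIntegral_swap_of_continuous hc, intervalIntegral.integral_of_le Real.pi_pos.le,
      integral_Ico_eq_integral_Ioc]
    simp only [intervalIntegral.integral_of_le (mul_nonneg zero_le_two hβ),
      integral_Ico_eq_integral_Ioc]
  · exact (hc.continuousOn.integrableOn_compact (isCompact_Icc.prod isCompact_Icc)).mono_set
      (prod_mono Ico_subset_Icc_self Ico_subset_Icc_self)

theorem length_nonneg (g : Metric β) (γ : ℝ → ℂ) : 0 ≤ g.length γ :=
  intervalIntegral.integral_nonneg zero_le_one fun _ _ => Real.sqrt_nonneg _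

theorem leastLength_nonneg (g : Metric β) (τ : ℂ → ℂ) : 0 ≤ g.leastLength τ := by
  refine Real.sInf_nonneg ?_
  rintro _ ⟨γ, -, -, rfl⟩
  exact g.length_nonneg γ

theorem leastLength_le (g : Metric β) {τ : ℂ → ℂ} {γ : ℝ → ℂ} {C : NNReal}
    (hγ : LipschitzOnWith C γ (Icc 0 1)) (h : γ 1 = τ (γ 0)) : g.leastLength τ ≤ g.length γ :=
  csInf_le ⟨0, by rintro _ ⟨γ, -, -, rfl⟩; exact g.length_nonneg γ⟩ ⟨γ, ⟨C, hγ⟩, h, rfl⟩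

theorem IsConformal.leastLength_le_integral (hg : g.IsConformal) {τ : ℂ → ℂ} {z z' : ℝ → ℂ}
    {c d : ℝ} (hcd : c ≤ d) (hz : ∀ u, HasDerivAt z (z' u) u) (hz' : Continuous z')
    (h : z d = τ (z c)) : g.leastLength τ ≤ ∫ u in c..d, g.density (z u) * ‖z' u‖ := by
  have hd : ∀ s, HasDerivAt (fun s => z ((d - c) * s + c))
      ((d - c) • z' ((d - c) * s + c)) s := fun s => by
    have haffine : HasDerivAt (fun s => (d - c) * s + c) (d - c) s := by
      simpa using ((hasDerivAt_id s).const_mul (d - c)).add_const c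
    exact (hz _).scomp s haffine
  have hC1 : ContDiff ℝ 1 fun s => z ((d - c) * s + c) := by
    rw [contDiff_one_iff_deriv]
    refine ⟨fun s => (hd s).differentiableAt, ?_⟩
    rw [funext fun s => (hd s).deriv]
    fun_prop
  obtain ⟨K, hK⟩ := hC1.locallyLipschitz.locallyLipschitzOn.exists_lipschitzOnWith_of_compact
    (isCompact_Icc (a := (0 : ℝ)) (b := 1))
  refine (g.leastLength_le hK (τ := τ) (by simpa using h)).trans_eq ?_
  have hsubst := intervalIntegral.mul_integral_comp_mul_add (a := 0) (b := 1)
    (f := fun u => g.density (z u) * ‖z' u‖) (d - c) c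
  rw [mul_zero, zero_add, mul_one, sub_add_cancel] at hsubst
  rw [hg.length_eq, ← hsubst, ← intervalIntegral.integral_const_mul]
  congr 1
  ext s
  rw [(hd s).deriv, norm_smul, Real.norm_of_nonneg (sub_nonneg.2 hcd)]
  ring

theorem LSigma_nonneg (g : Metric β) : 0 ≤ g.LSigma :=
  le_min (le_min (g.leastLength_nonneg _) (g.leastLength_nonneg _)) (g.leastLength_nonneg _)

theorem LSigma_le_glide (g : Metric β) : g.LSigma ≤ g.leastLength glide :=
  (min_le_left _ _).trans (min_le_left _ _)

theorem LSigma_le_vert_comp_glide (g : Metric β) : g.LSigma ≤ g.leastLength (vert β ∘ glide) :=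
  (min_le_left _ _).trans (min_le_right _ _)

/-! ### Averaging over horizontal lines -/

/-- The `g`-length of the horizontal line at height `y`, of horizontal displacement `2π`, in a
conformal metric. -/
def rowLength (g : Metric β) (y : ℝ) : ℝ :=
  ∫ x in (0 : ℝ)..(2 * Real.pi), g.density ⟨x, y⟩

theorem density_periodic (g : Metric β) (y : ℝ) :
    Function.Periodic (fun x => g.density ⟨x, y⟩) (2 * Real.pi) := fun x => by
  have hglide := g.density_glide (x + Real.pi) (-y)
  rw [neg_neg, g.density_glide x y] at hglide
  simpa only [two_mul, ← add_assoc] using hglide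

theorem integral_density_add (g : Metric β) (y c : ℝ) :
    ∫ x in (0 : ℝ)..(2 * Real.pi), g.density ⟨x + c, y⟩ = g.rowLength y := by
  rw [intervalIntegral.integral_comp_add_right (fun x => g.density ⟨x, y⟩) c, zero_add,
    add_comm (2 * Real.pi)]
  have := (g.density_periodic y).intervalIntegral_add_eq c 0
  rwa [zero_add] at this

theorem rowLength_pos (g : Metric β) (y : ℝ) : 0 < g.rowLength y :=
  intervalIntegral.intervalIntegral_pos_of_pos
    ((g.continuous_density_mk.comp (Continuous.prodMk_left y)).intervalIntegrable _ _)
    (fun _ => g.density_pos _) (by positivity)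

theorem continuous_rowLength (g : Metric β) : Continuous g.rowLength :=
  intervalIntegral.continuous_parametric_intervalIntegral_of_continuous'
    (f := fun y x => g.density ⟨x, y⟩) (g.continuous_density_mk.comp continuous_swap) _ _

theorem rowLength_neg (g : Metric β) (y : ℝ) : g.rowLength (-y) = g.rowLength y := by
  rw [← g.integral_density_add (-y) Real.pi]
  simp only [g.density_glide, rowLength]

theorem rowLength_vert (g : Metric β) (y : ℝ) : g.rowLength (y + 2 * β) = g.rowLength y := by
  simp only [rowLength, g.density_vert]

/-- The average of the density over the horizontal lines at heights `y` and `y + β`. Using both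
heights makes it symmetric about `β / 2`, so that the axes of `σ` and of `tσ` play equal roles. -/
def profile (g : Metric β) (y : ℝ) : ℝ :=
  (g.rowLength y + g.rowLength (y + β)) / (4 * Real.pi)

theorem continuous_profile (g : Metric β) : Continuous g.profile := by
  have := g.continuous_rowLength
  unfold profile
  fun_prop

theorem profile_nonneg (g : Metric β) (y : ℝ) : 0 ≤ g.profile y :=
  div_nonneg (add_pos (g.rowLength_pos _) (g.rowLength_pos _)).le (by positivity)

theorem profile_neg (g : Metric β) (y : ℝ) : g.profile (-y) = g.profile y := by
  have h : g.rowLength (-y + β) = g.rowLength (y + β) := by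
    rw [← g.rowLength_neg (y + β), ← g.rowLength_vert (-(y + β))]
    congr 1
    ring
  rw [profile, profile, g.rowLength_neg, h]

theorem profile_add (g : Metric β) (y : ℝ) : g.profile (y + β) = g.profile y := by
  have h : g.rowLength (y + β + β) = g.rowLength y := by
    rw [← g.rowLength_vert y, add_assoc, two_mul]
  rw [profile, profile, h, add_comm]

theorem profile_sub (g : Metric β) (y : ℝ) : g.profile (β - y) = g.profile y := by
  rw [← g.profile_neg y, ← g.profile_add (-y), neg_add_eq_sub]

theorem IsConformal.lH_le (hg : g.IsConformal) (y : ℝ) : g.lH ≤ g.rowLength y := by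
  have h := hg.leastLength_le_integral (τ := glide ∘ glide) (z := fun u : ℝ => ⟨u, y⟩) (c := 0)
    (d := 2 * Real.pi) (by positivity)
    (fun u => hasDerivAt_complex_mk (hasDerivAt_id u) (hasDerivAt_const u y)) continuous_const
    (by apply Complex.ext <;> simp [glide, two_mul])
  have hspeed : ‖(⟨1, 0⟩ : ℂ)‖ = 1 := norm_one
  simpa only [lH, rowLength, hspeed, mul_one] using h

theorem IsConformal.LSigma_le_profile (hg : g.IsConformal) (y : ℝ) :
    g.LSigma ≤ 2 * Real.pi * g.profile y := by
  have hH : g.LSigma ≤ g.lH := min_le_right _ _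
  have hrow := hg.lH_le y
  have hrow_add := hg.lH_le (y + β)
  have : 2 * Real.pi * g.profile y = (g.rowLength y + g.rowLength (y + β)) / 2 := by
    rw [profile]
    field_simp
    ring
  linarith

theorem mul_le_integral_rowLength {L c d e : ℝ} {Y w : ℝ → ℝ} (hY : Continuous Y)
    (hw : Continuous w) (h : ∀ x, L ≤ ∫ u in c..d, g.density ⟨x + e * u, Y u⟩ * w u) :
    2 * Real.pi * L ≤ ∫ u in c..d, g.rowLength (Y u) * w u := by
  have hc : Continuous (Function.uncurry fun x u => g.density ⟨x + e * u, Y u⟩ * w u) := by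
    have : Continuous fun p : ℝ × ℝ => (p.1 + e * p.2, Y p.2) := by fun_prop
    exact (g.continuous_density_mk.comp this).mul (by fun_prop)
  have hmono : ∫ _ in (0 : ℝ)..(2 * Real.pi), L ≤
      ∫ x in (0 : ℝ)..(2 * Real.pi), ∫ u in c..d, g.density ⟨x + e * u, Y u⟩ * w u :=
    intervalIntegral.integral_mono_on (by positivity) (by simp)
      ((intervalIntegral.continuous_parametric_intervalIntegral_of_continuous'
        hc _ _).intervalIntegrable _ _) fun x _ => h x
  rw [intervalIntegral_swap_of_continuous hc] at hmono
  simpa only [intervalIntegral.integral_mul_const, integral_density_add,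
    intervalIntegral.integral_const, sub_zero, smul_eq_mul] using hmono

theorem IsConformal.lV_le_rowLength (hg : g.IsConformal) (hβ : 0 ≤ β) :
    2 * Real.pi * g.lV ≤ ∫ y in (0 : ℝ)..(2 * β), g.rowLength y := by
  have hI : ‖(⟨0, 1⟩ : ℂ)‖ = 1 := Complex.norm_I
  have h := mul_le_integral_rowLength (g := g) (L := g.lV) (c := 0) (d := 2 * β) (e := 0)
    (w := fun _ => 1) continuous_id continuous_const fun x => by
      have h := hg.leastLength_le_integral (τ := vert β) (z := fun u : ℝ => ⟨x, u⟩) (c := 0)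
        (d := 2 * β) (by positivity)
        (fun u => hasDerivAt_complex_mk (hasDerivAt_const u x) (hasDerivAt_id u)) continuous_const
        (by apply Complex.ext <;> simp [vert])
      simpa only [lV, hI, zero_mul, add_zero, id] using h
  simpa only [id, mul_one] using h

theorem IsConformal.lV_le_profile (hg : g.IsConformal) (hβ : 0 ≤ β) :
    g.lV ≤ 4 * ∫ y in (0 : ℝ)..(β / 2), g.profile y := by
  have h := hg.lV_le_rowLength hβ
  have e : ∀ y, g.rowLength y + g.rowLength (y + β) = 4 * Real.pi * g.profile y := fun y => by
    rw [profile]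
    field_simp
  rw [integral_two_mul_eq_integral_add g.continuous_rowLength] at h
  simp only [e] at h
  rw [intervalIntegral.integral_const_mul,
    integral_eq_two_mul_half_of_symm g.continuous_profile g.profile_sub] at h
  refine le_of_mul_le_mul_left (h.trans_eq ?_) Real.two_pi_pos
  ring

end Metric

theorem hasDerivAt_arsinh_mul_sin (t u : ℝ) :
    HasDerivAt (fun u => Real.arsinh (t * Real.sin u))
      (t * Real.cos u / √(1 + (t * Real.sin u) ^ 2)) u := by
  refine (((Real.hasDerivAt_sin u).const_mul t).arsinh).congr_deriv ?_
  rw [smul_eq_mul, inv_mul_eq_div]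

theorem norm_mk_one_deriv_greatCircle (t u : ℝ) :
    ‖(⟨1, t * Real.cos u / √(1 + (t * Real.sin u) ^ 2)⟩ : ℂ)‖ = greatCircleSpeed t u := by
  have h : √(1 + (t * Real.sin u) ^ 2) ^ 2 = 1 + (t * Real.sin u) ^ 2 :=
    Real.sq_sqrt (by positivity)
  rw [Complex.norm_def, Complex.normSq_mk, greatCircleSpeed, ← Real.sqrt_div (by positivity)]
  congr 1
  rw [div_mul_div_comm, ← sq √_, h, eq_div_iff (by positivity), add_mul,
    div_mul_cancel₀ _ (by positivity)]
  linear_combination t ^ 2 * Real.sin_sq_add_cos_sq u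

namespace Metric

variable {β : ℝ} {g : Metric β}

theorem IsConformal.leastLength_le_greatCircle (hg : g.IsConformal) {τ : ℂ → ℂ} (y₀ : ℝ)
    (hτ : ∀ x y, τ ⟨x, y₀ + y⟩ = ⟨x + Real.pi, y₀ - y⟩) (t c : ℝ) :
    2 * Real.pi * g.leastLength τ ≤ ∫ u in c..(c + Real.pi),
      g.rowLength (y₀ + Real.arsinh (t * Real.sin u)) * greatCircleSpeed t u := by
  have hY : Continuous fun u => t * Real.cos u / √(1 + (t * Real.sin u) ^ 2) :=
    Continuous.div (by fun_prop) (by fun_prop) fun u => by positivity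
  refine mul_le_integral_rowLength (e := 1)
    (continuous_const.add (Real.continuous_arsinh.comp (by fun_prop)))
    (continuous_greatCircleSpeed t) fun x => ?_
  have h := hg.leastLength_le_integral (τ := τ)
    (z := fun u => ⟨x + 1 * u, y₀ + Real.arsinh (t * Real.sin u)⟩) (c := c) (d := c + Real.pi)
    (by linarith [Real.pi_pos]) (fun u => hasDerivAt_complex_mk
      (((hasDerivAt_id u).const_mul 1).const_add x) ((hasDerivAt_arsinh_mul_sin t u).const_add y₀))
    (continuous_complex_mk.comp (continuous_const.prodMk hY)) (by
      rw [hτ]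
      apply Complex.ext <;> simp [Real.sin_add_pi] <;> ring)
  simpa only [mul_one, norm_mk_one_deriv_greatCircle] using h

theorem IsConformal.LSigma_le_greatCircle (hg : g.IsConformal) (t c : ℝ) :
    g.LSigma ≤ ∫ u in c..(c + Real.pi),
      g.profile (Real.arsinh (t * Real.sin u)) * greatCircleSpeed t u := by
  have h₀ := hg.leastLength_le_greatCircle (τ := glide) 0
    (fun x y => by apply Complex.ext <;> simp [glide]) t c
  have h₁ := hg.leastLength_le_greatCircle (τ := vert β ∘ glide) β
    (fun x y => by apply Complex.ext <;> simp [glide, vert]; ring) t c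
  have hint : ∀ y₀, IntervalIntegrable (fun u =>
      g.rowLength (y₀ + Real.arsinh (t * Real.sin u)) * greatCircleSpeed t u) volume c
      (c + Real.pi) := fun y₀ =>
    ((g.continuous_rowLength.comp
      (continuous_const.add (Real.continuous_arsinh.comp (by fun_prop)))).mul
      (continuous_greatCircleSpeed t)).intervalIntegrable _ _
  have hsum : ∀ u, g.profile (Real.arsinh (t * Real.sin u)) * greatCircleSpeed t u =
      1 / (4 * Real.pi) *
        (g.rowLength (0 + Real.arsinh (t * Real.sin u)) * greatCircleSpeed t u +
          g.rowLength (β + Real.arsinh (t * Real.sin u)) * greatCircleSpeed t u) := fun u => by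
    rw [profile, zero_add, add_comm β]
    ring
  simp only [hsum]
  rw [intervalIntegral.integral_const_mul, intervalIntegral.integral_add (hint 0) (hint β)]
  calc g.LSigma = 1 / (4 * Real.pi) * (2 * Real.pi * g.LSigma + 2 * Real.pi * g.LSigma) := by
        field_simp
        ring
    _ ≤ 1 / (4 * Real.pi) * (2 * Real.pi * g.leastLength glide +
          2 * Real.pi * g.leastLength (vert β ∘ glide)) := by
        gcongr
        exacts [g.LSigma_le_glide, g.LSigma_le_vert_comp_glide]
    _ ≤ _ := by gcongr

end Metric

namespace Metric

variable {β : ℝ} {g : Metric β}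

/-- The integral of the squared density over the horizontal line at height `y`. -/
def rowArea (g : Metric β) (y : ℝ) : ℝ :=
  ∫ x in (0 : ℝ)..(2 * Real.pi), g.density ⟨x, y⟩ ^ 2

theorem continuous_rowArea (g : Metric β) : Continuous g.rowArea :=
  intervalIntegral.continuous_parametric_intervalIntegral_of_continuous'
    (f := fun y x => g.density ⟨x, y⟩ ^ 2) (g.continuous_sq_density_mk.comp continuous_swap) _ _

theorem sq_rowLength_le (g : Metric β) (y : ℝ) :
    g.rowLength y ^ 2 ≤ 2 * Real.pi * g.rowArea y := by
  have hi : Continuous fun x => g.density ⟨x, y⟩ :=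
    g.continuous_density_mk.comp (Continuous.prodMk_left y)
  have := sq_integral_mul_le hi (continuous_const (y := (1 : ℝ))) Real.two_pi_pos.le
  simp only [mul_one, one_pow, intervalIntegral.integral_const, sub_zero, smul_eq_mul] at this
  rwa [mul_comm, rowLength, rowArea]

theorem rowArea_eq_add (g : Metric β) (y : ℝ) :
    g.rowArea y = (∫ x in (0 : ℝ)..Real.pi, g.density ⟨x, y⟩ ^ 2) +
      ∫ x in (0 : ℝ)..Real.pi, g.density ⟨x, -y⟩ ^ 2 := by
  have hi : Continuous fun x => g.density ⟨x, y⟩ ^ 2 :=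
    g.continuous_sq_density_mk.comp (Continuous.prodMk_left y)
  have hshift := intervalIntegral.integral_comp_add_right (a := 0) (b := Real.pi)
    (fun x => g.density ⟨x, y⟩ ^ 2) Real.pi
  rw [zero_add, ← two_mul] at hshift
  rw [rowArea, ← intervalIntegral.integral_add_adjacent_intervals
    (hi.intervalIntegrable 0 Real.pi) (hi.intervalIntegrable _ _), ← hshift]
  congr 2
  ext x
  rw [← g.density_glide x (-y), neg_neg]

theorem IsConformal.integral_rowArea (hg : g.IsConformal) (hβ : 0 ≤ β) :
    ∫ y in (0 : ℝ)..(2 * β), g.rowArea y = 2 * g.vol := by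
  set S : ℝ → ℝ := fun y => ∫ x in (0 : ℝ)..Real.pi, g.density ⟨x, y⟩ ^ 2 with hS
  have hSc : Continuous S :=
    intervalIntegral.continuous_parametric_intervalIntegral_of_continuous'
      (f := fun y x => g.density ⟨x, y⟩ ^ 2) (g.continuous_sq_density_mk.comp continuous_swap) _ _
  have hper : Function.Periodic S (2 * β) := fun y => by simp only [hS, g.density_vert]
  have hreflect := hper.intervalIntegral_add_eq (-(2 * β)) 0
  rw [neg_add_cancel, zero_add] at hreflect
  have hneg : Continuous fun y => S (-y) := hSc.comp continuous_neg
  simp only [g.rowArea_eq_add]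
  change ∫ y in (0 : ℝ)..(2 * β), (S y + S (-y)) = _
  rw [hg.vol_eq hβ, intervalIntegral.integral_add (hSc.intervalIntegrable _ _)
    (hneg.intervalIntegrable _ _), intervalIntegral.integral_comp_neg S, neg_zero, hreflect]
  exact (two_mul _).symm

theorem eight_mul_sq_profile_le (g : Metric β) (y : ℝ) :
    8 * Real.pi ^ 2 * g.profile y ^ 2 ≤ g.rowLength y ^ 2 + g.rowLength (y + β) ^ 2 := by
  have h : 8 * Real.pi ^ 2 * g.profile y ^ 2 = (g.rowLength y + g.rowLength (y + β)) ^ 2 / 2 := by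
    rw [profile]
    field_simp
    ring
  rw [h]
  linarith [add_sq_le (a := g.rowLength y) (b := g.rowLength (y + β))]

theorem IsConformal.integral_sq_profile_le_vol (hg : g.IsConformal) (hβ : 0 ≤ β) :
    4 * Real.pi * ∫ y in (0 : ℝ)..(β / 2), g.profile y ^ 2 ≤ g.vol := by
  have hr := g.continuous_rowLength
  have hp := g.continuous_profile
  refine le_of_mul_le_mul_left ?_ (by positivity : 0 < 4 * Real.pi)
  calc 4 * Real.pi * (4 * Real.pi * ∫ y in (0 : ℝ)..(β / 2), g.profile y ^ 2)
      = ∫ y in (0 : ℝ)..β, 8 * Real.pi ^ 2 * g.profile y ^ 2 := by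
        rw [intervalIntegral.integral_const_mul,
          integral_eq_two_mul_half_of_symm (f := fun y => g.profile y ^ 2) (b := β) (hp.pow 2)
            fun y => by rw [g.profile_sub]]
        ring
    _ ≤ ∫ y in (0 : ℝ)..β, (g.rowLength y ^ 2 + g.rowLength (y + β) ^ 2) :=
        intervalIntegral.integral_mono_on hβ
          ((continuous_const.mul (hp.pow 2)).intervalIntegrable _ _)
          (Continuous.intervalIntegrable (by fun_prop) _ _) fun y _ => g.eight_mul_sq_profile_le y
    _ = ∫ y in (0 : ℝ)..(2 * β), g.rowLength y ^ 2 :=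
        (integral_two_mul_eq_integral_add (hr.pow 2) β).symm
    _ ≤ ∫ y in (0 : ℝ)..(2 * β), 2 * Real.pi * g.rowArea y :=
        intervalIntegral.integral_mono_on (by positivity) ((hr.pow 2).intervalIntegrable _ _)
          ((continuous_const.mul g.continuous_rowArea).intervalIntegrable _ _)
          fun y _ => g.sq_rowLength_le y
    _ = 4 * Real.pi * g.vol := by
        rw [intervalIntegral.integral_const_mul, hg.integral_rowArea hβ]
        ring

end Metric

/-! ### The isosystolic inequality -/

theorem sqrt_one_add_sinh_sq (y : ℝ) : √(1 + Real.sinh y ^ 2) = Real.cosh y := by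
  rw [← Real.cosh_sq', Real.sqrt_sq (Real.cosh_pos y).le]

theorem continuous_one_div_cosh : Continuous fun y => 1 / Real.cosh y :=
  continuous_const.div Real.continuous_cosh fun _ => (Real.cosh_pos _).ne'

theorem integral_one_div_cosh (a b : ℝ) :
    ∫ y in a..b, 1 / Real.cosh y = Real.arctan (Real.sinh b) - Real.arctan (Real.sinh a) := by
  refine intervalIntegral.integral_eq_sub_of_hasDerivAt
    (fun y _ => (Real.hasDerivAt_sinh y).arctan.congr_deriv ?_)
    (continuous_one_div_cosh.intervalIntegrable _ _)
  rw [← Real.cosh_sq']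
  field_simp [(Real.cosh_pos y).ne']

theorem integral_one_div_cosh_sq (a b : ℝ) :
    ∫ y in a..b, (1 / Real.cosh y) ^ 2 =
      Real.sinh b / Real.cosh b - Real.sinh a / Real.cosh a := by
  refine intervalIntegral.integral_eq_sub_of_hasDerivAt (f := fun y => Real.sinh y / Real.cosh y)
    (fun y _ => ?_) ((continuous_one_div_cosh.pow 2).intervalIntegrable _ _)
  have h := (Real.cosh_pos y).ne'
  refine ((Real.hasDerivAt_sinh y).div (Real.hasDerivAt_cosh y) h).congr_deriv ?_
  field_simp
  linarith [Real.cosh_sq' y]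

theorem sinh_div_cosh_le_arctan_sinh {a : ℝ} (ha : 0 ≤ a) :
    Real.sinh a / Real.cosh a ≤ Real.arctan (Real.sinh a) := by
  have h := Real.sin_le (Real.arctan_nonneg.2 (Real.sinh_nonneg_iff.2 ha))
  rwa [Real.sin_arctan, sqrt_one_add_sinh_sq] at h

/-- The conformal factor of a spherical cap of Mercator radius `a`, continued as a flat cylinder
beyond it, as a function of the Mercator latitude `y`. -/
def capProfile (a y : ℝ) : ℝ := 1 / Real.cosh (min y a)

theorem continuous_capProfile (a : ℝ) : Continuous (capProfile a) :=
  Continuous.div continuous_const (Real.continuous_cosh.comp (by fun_prop))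
    fun _ => (Real.cosh_pos _).ne'

theorem capProfile_pos (a y : ℝ) : 0 < capProfile a y := one_div_pos.2 (Real.cosh_pos _)

/-- The length of the meridian segment `0 ≤ y ≤ c` for the conformal factor `capProfile a`. -/
def capLength (a c : ℝ) : ℝ := ∫ y in (0 : ℝ)..c, capProfile a y

/-- The area of `0 ≤ y ≤ c` per unit of longitude for the conformal factor `capProfile a`. -/
def capArea (a c : ℝ) : ℝ := ∫ y in (0 : ℝ)..c, capProfile a y ^ 2

theorem capLength_pos (a : ℝ) {c : ℝ} (hc : 0 < c) : 0 < capLength a c :=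
  intervalIntegral.intervalIntegral_pos_of_pos ((continuous_capProfile a).intervalIntegrable _ _)
    (capProfile_pos a) hc

theorem capArea_pos (a : ℝ) {c : ℝ} (hc : 0 < c) : 0 < capArea a c :=
  intervalIntegral.intervalIntegral_pos_of_pos
    (((continuous_capProfile a).pow 2).intervalIntegrable _ _)
    (fun y => pow_pos (capProfile_pos a y) 2) hc

theorem integral_comp_capProfile {F : ℝ → ℝ → ℝ} (hF : Continuous (Function.uncurry F)) {a c : ℝ}
    (ha : 0 ≤ a) (hac : a ≤ c) :
    ∫ y in (0 : ℝ)..c, F y (capProfile a y) =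
      (∫ y in (0 : ℝ)..a, F y (1 / Real.cosh y)) + ∫ y in a..c, F y (1 / Real.cosh a) := by
  have hc : Continuous fun y => F y (capProfile a y) :=
    hF.comp (continuous_id.prodMk (continuous_capProfile a))
  rw [← intervalIntegral.integral_add_adjacent_intervals (hc.intervalIntegrable 0 a)
    (hc.intervalIntegrable a c)]
  congr 1
  · refine intervalIntegral.integral_congr fun y hy => ?_
    rw [uIcc_of_le ha] at hy
    simp only [capProfile, min_eq_left hy.2]
  · refine intervalIntegral.integral_congr fun y hy => ?_
    rw [uIcc_of_le hac] at hy
    simp only [capProfile, min_eq_right hy.1]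

theorem capLength_eq {a c : ℝ} (ha : 0 ≤ a) (hac : a ≤ c) :
    capLength a c = Real.arctan (Real.sinh a) + (c - a) / Real.cosh a := by
  rw [capLength, integral_comp_capProfile (F := fun _ p => p) continuous_snd ha hac,
    integral_one_div_cosh]
  simp [div_eq_mul_inv]

theorem capArea_eq {a c : ℝ} (ha : 0 ≤ a) (hac : a ≤ c) :
    capArea a c = Real.sinh a / Real.cosh a + (c - a) / Real.cosh a ^ 2 := by
  rw [capArea, integral_comp_capProfile (F := fun _ p => p ^ 2) (continuous_snd.pow 2) ha hac,
    integral_one_div_cosh_sq]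
  simp [div_eq_mul_inv]

/-- `a` is the Mercator radius of the spherical caps of the extremal metric of conformal type `β`.
The parallel at latitude `a` has length `2π / cosh a`; `cosh a ≤ 2` says that it is no shorter than
a great semicircle. A flat band beyond the caps requires equality. -/
structure IsCapRadius (β a : ℝ) : Prop where
  pos : 0 < a
  le_half : a ≤ β / 2
  cosh_le_two : Real.cosh a ≤ 2
  eq_half_or : a = β / 2 ∨ Real.cosh a = 2

namespace IsCapRadius

variable {β a : ℝ}

theorem half_pos (h : IsCapRadius β a) : 0 < β / 2 := h.pos.trans_le h.le_half

theorem capArea_div_le (h : IsCapRadius β a) :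
    capArea a (β / 2) / (2 * capLength a (β / 2)) ≤ 1 / Real.cosh a := by
  have hcosh := Real.cosh_pos a
  have hsinh := sinh_div_cosh_le_arctan_sinh h.pos.le
  have harctan : 0 ≤ Real.arctan (Real.sinh a) :=
    Real.arctan_nonneg.2 (Real.sinh_nonneg_iff.2 h.pos.le)
  have hband : 0 ≤ (β / 2 - a) / Real.cosh a := div_nonneg (sub_nonneg.2 h.le_half) hcosh.le
  have hflat : (β / 2 - a) / Real.cosh a ^ 2 * Real.cosh a = (β / 2 - a) / Real.cosh a := by
    field_simp
  have hcap : Real.sinh a / Real.cosh a * Real.cosh a ≤ 2 * Real.arctan (Real.sinh a) := by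
    calc _ ≤ Real.arctan (Real.sinh a) * 2 :=
          mul_le_mul hsinh h.cosh_le_two hcosh.le harctan
      _ = _ := mul_comm _ _
  rw [div_le_div_iff₀ (mul_pos two_pos (capLength_pos a h.half_pos)) hcosh, one_mul,
    capArea_eq h.pos.le h.le_half, capLength_eq h.pos.le h.le_half, add_mul, hflat]
  linarith

end IsCapRadius

namespace Metric

variable {β : ℝ} {g : Metric β}

theorem IsConformal.two_mul_LSigma_le_greatCircle (hg : g.IsConformal) (t : ℝ) :
    2 * g.LSigma ≤ ∫ u in (-Real.pi)..Real.pi,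
      g.profile (Real.arsinh (t * Real.sin u)) * greatCircleSpeed t u := by
  have hleft := hg.LSigma_le_greatCircle t (-Real.pi)
  have hright := hg.LSigma_le_greatCircle t 0
  rw [neg_add_cancel] at hleft
  rw [zero_add] at hright
  have hi : Continuous fun u =>
      g.profile (Real.arsinh (t * Real.sin u)) * greatCircleSpeed t u :=
    (g.continuous_profile.comp (Real.continuous_arsinh.comp (by fun_prop))).mul
      (continuous_greatCircleSpeed t)
  rw [← intervalIntegral.integral_add_adjacent_intervals (hi.intervalIntegrable _ 0)
    (hi.intervalIntegrable _ _)]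
  linarith

theorem IsConformal.LSigma_mul_le_integral_cap (hg : g.IsConformal) {a C : ℝ} (ha : 0 < a)
    (hC : C ≤ 1 / Real.cosh a) :
    g.LSigma * (Real.sinh a / Real.cosh a - C * Real.arctan (Real.sinh a)) ≤
      Real.pi * ∫ y in (0 : ℝ)..a, g.profile y * (1 / Real.cosh y - C) := by
  have hp := g.continuous_profile
  have hpX : Continuous fun X => g.profile (Real.arsinh X) := hp.comp Real.continuous_arsinh
  have hS : ∀ X : ℝ, √(1 + X ^ 2) ≠ 0 := fun X => (Real.sqrt_pos.2 (by positivity)).ne'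
  have key := mul_le_integral_of_le_greatCircle (τ := Real.sinh a) (C := C)
    (Real.sinh_pos_iff.2 ha) (by rwa [sqrt_one_add_sinh_sq]) hpX (fun X => g.profile_nonneg _)
    (mul_nonneg zero_le_two g.LSigma_nonneg) fun t _ => hg.two_mul_LSigma_le_greatCircle t
  have hsubst := intervalIntegral.integral_comp_mul_deriv (a := -a) (b := a) (f := Real.sinh)
    (f' := Real.cosh) (g := fun X => g.profile (Real.arsinh X) / √(1 + X ^ 2) *
      (1 / √(1 + X ^ 2) - C)) (fun y _ => Real.hasDerivAt_sinh y)
    Real.continuous_cosh.continuousOn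
    ((hpX.div (by fun_prop) hS).mul ((continuous_const.div (by fun_prop) hS).sub continuous_const))
  have hintegrand : ∀ y, ((fun X => g.profile (Real.arsinh X) / √(1 + X ^ 2) *
      (1 / √(1 + X ^ 2) - C)) ∘ Real.sinh) y * Real.cosh y =
      g.profile y * (1 / Real.cosh y - C) := fun y => by
    simp only [Function.comp, sqrt_one_add_sinh_sq, Real.arsinh_sinh]
    field_simp [(Real.cosh_pos y).ne']
  simp only [hintegrand] at hsubst
  rw [sqrt_one_add_sinh_sq, ← Real.sinh_neg, ← hsubst, integral_neg_self_of_even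
    (f := fun y => g.profile y * (1 / Real.cosh y - C))
    (hp.mul (continuous_one_div_cosh.sub continuous_const))
    (fun y => by simp only [g.profile_neg, Real.cosh_neg])] at key
  linarith

theorem IsConformal.LSigma_mul_le_integral_band (hg : g.IsConformal) {a c : ℝ} (hac : a ≤ c) :
    g.LSigma * (c - a) ≤ 2 * Real.pi * ∫ y in a..c, g.profile y := by
  have hmono : ∫ _ in a..c, g.LSigma ≤ ∫ y in a..c, 2 * Real.pi * g.profile y :=
    intervalIntegral.integral_mono_on hac (by simp)
      ((continuous_const.mul g.continuous_profile).intervalIntegrable _ _)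
      fun y _ => hg.LSigma_le_profile y
  rwa [intervalIntegral.integral_const, smul_eq_mul, mul_comm,
    intervalIntegral.integral_const_mul] at hmono

theorem IsConformal.LSigma_mul_le_integral_capProfile (hg : g.IsConformal) {a C : ℝ}
    (ha : IsCapRadius β a) (hC : C ≤ 1 / Real.cosh a) :
    g.LSigma * (capArea a (β / 2) - C * capLength a (β / 2)) ≤
      Real.pi * ∫ y in (0 : ℝ)..(β / 2), g.profile y * (capProfile a y - C) := by
  have hp := g.continuous_profile
  have hband : g.LSigma * ((β / 2 - a) / Real.cosh a * (1 / Real.cosh a - C)) ≤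
      Real.pi * ∫ y in a..(β / 2), g.profile y * (1 / Real.cosh a - C) := by
    rcases ha.eq_half_or with h | h
    · simp [h]
    · rw [h] at hC ⊢
      rw [intervalIntegral.integral_mul_const]
      calc g.LSigma * ((β / 2 - a) / 2 * (1 / 2 - C))
          = g.LSigma * (β / 2 - a) * ((1 / 2 - C) / 2) := by ring
        _ ≤ 2 * Real.pi * (∫ y in a..(β / 2), g.profile y) * ((1 / 2 - C) / 2) :=
            mul_le_mul_of_nonneg_right (hg.LSigma_mul_le_integral_band ha.le_half) (by linarith)
        _ = _ := by ring
  have hcap := hg.LSigma_mul_le_integral_cap ha.pos hC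
  rw [integral_comp_capProfile (F := fun y p => g.profile y * (p - C)) (by fun_prop) ha.pos.le
    ha.le_half, capArea_eq ha.pos.le ha.le_half, capLength_eq ha.pos.le ha.le_half]
  calc _ = g.LSigma * (Real.sinh a / Real.cosh a - C * Real.arctan (Real.sinh a)) +
        g.LSigma * ((β / 2 - a) / Real.cosh a * (1 / Real.cosh a - C)) := by
          field_simp
          ring
    _ ≤ _ := by linarith

-- The weight `C = I / (2 b)` of the vertical lines balances the two terms in AM-GM below.
theorem IsConformal.capArea_mul_le_integral (hg : g.IsConformal) {a : ℝ} (ha : IsCapRadius β a) :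
    capArea a (β / 2) / 2 * (g.LSigma / Real.pi + g.lV / (4 * capLength a (β / 2))) ≤
      ∫ y in (0 : ℝ)..(β / 2), g.profile y * capProfile a y := by
  have hp := g.continuous_profile
  have hcap := continuous_capProfile a
  have hb := capLength_pos a ha.half_pos
  have hI := capArea_pos a ha.half_pos
  set C := capArea a (β / 2) / (2 * capLength a (β / 2)) with hC
  have hCb : capArea a (β / 2) - C * capLength a (β / 2) = capArea a (β / 2) / 2 := by
    rw [hC]
    field_simp
    ring
  have hsigma := hg.LSigma_mul_le_integral_capProfile ha ha.capArea_div_le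
  have hvert : C * (g.lV / 4) ≤ C * ∫ y in (0 : ℝ)..(β / 2), g.profile y := by
    have := hg.lV_le_profile (by linarith [ha.half_pos])
    gcongr
    linarith
  have hsplit : ∫ y in (0 : ℝ)..(β / 2), g.profile y * capProfile a y =
      (∫ y in (0 : ℝ)..(β / 2), g.profile y * (capProfile a y - C)) +
        C * ∫ y in (0 : ℝ)..(β / 2), g.profile y := by
    rw [← intervalIntegral.integral_const_mul, ← intervalIntegral.integral_add
      (Continuous.intervalIntegrable (by fun_prop) _ _)
      (Continuous.intervalIntegrable (by fun_prop) _ _)]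
    congr 1
    ext y
    ring
  rw [← hC, hCb, ← div_le_iff₀' Real.pi_pos] at hsigma
  rw [hsplit]
  refine le_trans (le_of_eq ?_) (add_le_add hsigma hvert)
  rw [hC]
  field_simp

theorem IsConformal.LSigma_mul_lV_le (hg : g.IsConformal) {a : ℝ} (ha : IsCapRadius β a) :
    g.LSigma * g.lV ≤ capLength a (β / 2) / capArea a (β / 2) * g.vol := by
  have hβ := ha.half_pos
  have hb := capLength_pos a hβ
  have hI := capArea_pos a hβ
  have hL := g.LSigma_nonneg
  have hl : 0 ≤ g.lV := g.leastLength_nonneg _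
  have hvol := hg.integral_sq_profile_le_vol (by linarith)
  have hCS := sq_integral_mul_le g.continuous_profile (continuous_capProfile a) hβ.le
  have hlower := pow_le_pow_left₀ (by positivity) (hg.capArea_mul_le_integral ha) 2
  set L := g.LSigma
  set l := g.lV
  set b := capLength a (β / 2)
  set I := capArea a (β / 2)
  set M := ∫ y in (0 : ℝ)..(β / 2), g.profile y ^ 2
  have hAMGM : L / Real.pi * (l / (4 * b)) ≤ (1 / 2 * (L / Real.pi + l / (4 * b))) ^ 2 := by
    linarith [four_mul_le_sq_add (L / Real.pi) (l / (4 * b))]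
  have hM : I * (L / Real.pi * (l / (4 * b))) ≤ M := by
    refine le_of_mul_le_mul_right ?_ hI
    calc I * (L / Real.pi * (l / (4 * b))) * I = I ^ 2 * (L / Real.pi * (l / (4 * b))) := by ring
      _ ≤ I ^ 2 * (1 / 2 * (L / Real.pi + l / (4 * b))) ^ 2 := by gcongr
      _ = (I / 2 * (L / Real.pi + l / (4 * b))) ^ 2 := by ring
      _ ≤ M * I := hlower.trans hCS
  calc L * l = b / I * (4 * Real.pi * (I * (L / Real.pi * (l / (4 * b))))) := by field_simp
    _ ≤ b / I * (4 * Real.pi * M) := by gcongr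
    _ ≤ b / I * g.vol := by gcongr

end Metric

/-! ### Lower bounds for lengths -/

theorem lipschitzOnWith_Icc_of_eventually_abs_sub_le {f : ℝ → ℝ} {K : NNReal} {a b : ℝ}
    (hf : ContinuousOn f (Icc a b))
    (hK : ∀ s ∈ Ico a b, ∀ᶠ r in 𝓝[>] s, |f r - f s| ≤ K * (r - s)) :
    LipschitzOnWith K f (Icc a b) := by
  refine LipschitzOnWith.of_dist_le_mul fun x hx y hy => ?_
  wlog hxy : x ≤ y generalizing x y
  · rw [dist_comm, dist_comm x y]
    exact this y hy x hx (le_of_not_ge hxy)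
  have hsub : Icc x y ⊆ Icc a b := Icc_subset_Icc hx.1 hy.2
  have hslope : ∀ s ∈ Ico x y, ∀ r, (K : ℝ) < r →
      ∃ᶠ z in 𝓝[>] s, slope (fun s => |f s - f x|) s z < r := by
    refine fun s hs r hr => Eventually.frequently ?_
    filter_upwards [self_mem_nhdsWithin, hK s ⟨hx.1.trans hs.1, hs.2.trans_le hy.2⟩] with z hz hle
    rw [slope_def_field]
    refine lt_of_le_of_lt ((div_le_iff₀ (sub_pos.2 hz)).2 ?_) hr
    calc |f z - f x| - |f s - f x| ≤ |f z - f x - (f s - f x)| := abs_sub_abs_le_abs_sub _ _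
      _ = |f z - f s| := by rw [sub_sub_sub_cancel_right]
      _ ≤ K * (z - s) := hle
  have hle := image_le_of_liminf_slope_right_le_deriv_boundary (B := fun s => K * (s - x))
    (B' := fun _ => K) ((hf.mono hsub).sub continuousOn_const).abs (by simp) (by fun_prop)
    (fun s _ => (((hasDerivAt_id s).sub_const x).const_mul (K : ℝ)).hasDerivWithinAt.congr_deriv
      (mul_one _)) hslope (right_mem_Icc.2 hxy)
  rwa [dist_comm, dist_comm x y, Real.dist_eq, Real.dist_eq, abs_of_nonneg (sub_nonneg.2 hxy)]

theorem intervalIntegrable_mul_norm_deriv {E : Type*} [NormedAddCommGroup E] [NormedSpace ℝ E]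
    [CompleteSpace E] {f : ℝ → ℝ} {γ : ℝ → E} {C : NNReal} {a b : ℝ} (hab : a ≤ b)
    (hf : ContinuousOn f (Icc a b)) (hγ : LipschitzOnWith C γ (Icc a b)) :
    IntervalIntegrable (fun s => f s * ‖deriv γ s‖) volume a b := by
  rw [intervalIntegrable_iff_integrableOn_Icc_of_le hab]
  refine IntegrableOn.continuousOn_mul hf ?_ isCompact_Icc
  rw [integrableOn_Icc_iff_integrableOn_Ioo]
  refine Measure.integrableOn_of_bounded (M := C) (by simp)
    (stronglyMeasurable_deriv γ).norm.aestronglyMeasurable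
    ((ae_restrict_iff' measurableSet_Ioo).2 (Eventually.of_forall fun s hs => ?_))
  rw [norm_norm]
  exact norm_deriv_le_of_lipschitzOn (Icc_mem_nhds hs.1 hs.2) hγ

section SlopeLE

variable {E E' : Type*} [NormedAddCommGroup E] [NormedAddCommGroup E'] {h ρ : E → ℝ}

/-- The pointwise Lipschitz constant of `h` at `z` is at most `ρ z`. For a conformal metric of
density `ρ`, such an `h` calibrates: it bounds lengths of curves from below. -/
def SlopeLE (h ρ : E → ℝ) : Prop :=
  ∀ z, ∀ ε > 0, ∀ᶠ w in 𝓝 z, |h w - h z| ≤ (ρ z + ε) * ‖w - z‖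

namespace SlopeLE

theorem mono {ρ' : E → ℝ} (hh : SlopeLE h ρ) (hle : ∀ z, ρ z ≤ ρ' z) : SlopeLE h ρ' :=
  fun z ε hε => by
    filter_upwards [hh z ε hε] with w hw
    exact hw.trans (by gcongr; exact hle z)

theorem comp_lipschitzWith (hh : SlopeLE h ρ) (hρ : ∀ z, 0 ≤ ρ z) {F : E' → E}
    (hF : LipschitzWith 1 F) : SlopeLE (fun z => h (F z)) fun z => ρ (F z) := by
  intro z ε hε
  filter_upwards [hF.continuous.continuousAt.eventually (hh (F z) ε hε)] with w hw
  have hFw : ‖F w - F z‖ ≤ ‖w - z‖ := by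
    simpa only [dist_eq_norm, NNReal.coe_one, one_mul] using hF.dist_le_mul w z
  have := hρ (F z)
  exact hw.trans (by gcongr)

protected theorem continuous (hh : SlopeLE h ρ) : Continuous h := by
  refine continuous_iff_continuousAt.2 fun z => tendsto_iff_norm_sub_tendsto_zero.2 ?_
  have hlim : Tendsto (fun w => (ρ z + 1) * ‖w - z‖) (𝓝 z) (𝓝 0) := by
    simpa only [mul_zero] using (tendsto_norm_sub_self z).const_mul (ρ z + 1)
  exact squeeze_zero' (Eventually.of_forall fun _ => norm_nonneg _) (hh z 1 one_pos) hlim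

theorem lipschitzOnWith_comp (hh : SlopeLE h ρ) {γ : ℝ → E} {C M : NNReal} {a b : ℝ}
    (hM : ∀ s ∈ Icc a b, ρ (γ s) + 1 ≤ M) (hγ : LipschitzOnWith C γ (Icc a b)) :
    LipschitzOnWith (M * C) (fun s => h (γ s)) (Icc a b) := by
  refine lipschitzOnWith_Icc_of_eventually_abs_sub_le
    (hh.continuous.comp_continuousOn hγ.continuousOn) fun s hs => ?_
  have hs' := Ico_subset_Icc_self hs
  have hmem : ∀ᶠ r in 𝓝[>] s, r ∈ Icc a b := by
    filter_upwards [Ioo_mem_nhdsGT hs.2] with r hr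
    exact ⟨hs.1.trans hr.1.le, hr.2.le⟩
  have hlim : Tendsto γ (𝓝[>] s) (𝓝 (γ s)) :=
    (hγ.continuousOn s hs').tendsto.mono_left (le_inf nhdsWithin_le_nhds (le_principal_iff.2 hmem))
  filter_upwards [self_mem_nhdsWithin, hmem, hlim.eventually (hh (γ s) 1 one_pos)]
    with r hr hrab hle
  calc |h (γ r) - h (γ s)| ≤ (ρ (γ s) + 1) * ‖γ r - γ s‖ := hle
    _ ≤ M * (C * ‖r - s‖) := mul_le_mul (hM s hs') (hγ.norm_sub_le hrab hs') (norm_nonneg _) M.2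
    _ = _ := by rw [Real.norm_of_nonneg (sub_pos.2 hr).le, NNReal.coe_mul, mul_assoc]

theorem deriv_comp_le [NormedSpace ℝ E] (hh : SlopeLE h ρ) (hρ : ∀ z, 0 ≤ ρ z) {γ : ℝ → E} {s : ℝ}
    (hγ : DifferentiableAt ℝ γ s) :
    deriv (fun s => h (γ s)) s ≤ ρ (γ s) * ‖deriv γ s‖ := by
  by_cases hd : DifferentiableAt ℝ (fun s => h (γ s)) s
  swap
  · rw [deriv_zero_of_not_differentiableAt hd]
    exact mul_nonneg (hρ _) (norm_nonneg _)
  have hle : ∀ ε > 0, deriv (fun s => h (γ s)) s ≤ (ρ (γ s) + ε) * ‖deriv γ s‖ := by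
    intro ε hε
    refine le_of_tendsto_of_tendsto (hasDerivAt_iff_tendsto_slope.1 hd.hasDerivAt)
      ((hasDerivAt_iff_tendsto_slope.1 hγ.hasDerivAt).norm.const_mul (ρ (γ s) + ε)) ?_
    filter_upwards [(hγ.continuousAt.tendsto.mono_left nhdsWithin_le_nhds).eventually
      (hh (γ s) ε hε)] with r hr
    rw [slope_def_module, slope_def_module, norm_smul, smul_eq_mul, norm_inv, Real.norm_eq_abs]
    calc (r - s)⁻¹ * (h (γ r) - h (γ s)) ≤ |r - s|⁻¹ * |h (γ r) - h (γ s)| := by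
          rw [← abs_inv, ← abs_mul]
          exact le_abs_self _
      _ ≤ |r - s|⁻¹ * ((ρ (γ s) + ε) * ‖γ r - γ s‖) := by gcongr
      _ = _ := by ring
  have hlim : Tendsto (fun ε => (ρ (γ s) + ε) * ‖deriv γ s‖) (𝓝[>] 0)
      (𝓝 ((ρ (γ s) + 0) * ‖deriv γ s‖)) :=
    (Continuous.tendsto (by fun_prop) 0).mono_left nhdsWithin_le_nhds
  rw [add_zero] at hlim
  exact ge_of_tendsto hlim (mem_of_superset self_mem_nhdsWithin hle)

theorem sub_le_integral [NormedSpace ℝ E] [FiniteDimensional ℝ E] (hh : SlopeLE h ρ)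
    (hρ : ∀ z, 0 ≤ ρ z) (hρc : Continuous ρ) {γ : ℝ → E} {C : NNReal} {a b : ℝ} (hab : a ≤ b)
    (hγ : LipschitzOnWith C γ (Icc a b)) :
    h (γ b) - h (γ a) ≤ ∫ s in a..b, ρ (γ s) * ‖deriv γ s‖ := by
  have hργ : ContinuousOn (fun s => ρ (γ s)) (Icc a b) := hρc.comp_continuousOn hγ.continuousOn
  obtain ⟨M, hM⟩ := isCompact_Icc.bddAbove_image hργ
  have hlip : LipschitzOnWith ((M + 1).toNNReal * C) (fun s => h (γ s)) (uIcc a b) := by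
    rw [uIcc_of_le hab]
    refine hh.lipschitzOnWith_comp (fun s hs => ?_) hγ
    exact (add_le_add_left (hM (mem_image_of_mem _ hs)) 1).trans (Real.le_coe_toNNReal _)
  have hac := hlip.absolutelyContinuousOnInterval
  rw [← hac.integral_deriv_eq_sub]
  refine intervalIntegral.integral_mono_ae_restrict hab hac.intervalIntegrable_deriv
    (intervalIntegrable_mul_norm_deriv hab hργ hγ) ?_
  have hdiff := hγ.ae_differentiableWithinAt (μ := volume) measurableSet_Icc
  rw [← restrict_Ioo_eq_restrict_Icc] at hdiff ⊢
  filter_upwards [hdiff, ae_restrict_mem measurableSet_Ioo] with s hs hsab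
  exact hh.deriv_comp_le hρ (hs.differentiableAt (Icc_mem_nhds hsab.1 hsab.2))

end SlopeLE

theorem slopeLE_norm_fderiv [NormedSpace ℝ E] {h' : E → E →L[ℝ] ℝ}
    (hh : ∀ z, HasFDerivAt h (h' z) z) : SlopeLE h fun z => ‖h' z‖ := by
  intro z ε hε
  filter_upwards [(hh z).isLittleO.def hε] with w hw
  calc |h w - h z| ≤ ‖h w - h z - h' z (w - z)‖ + ‖h' z (w - z)‖ := by
        simpa using norm_add_le (h w - h z - h' z (w - z)) (h' z (w - z))
    _ ≤ ε * ‖w - z‖ + ‖h' z‖ * ‖w - z‖ := add_le_add hw ((h' z).le_opNorm _)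
    _ = (‖h' z‖ + ε) * ‖w - z‖ := by ring

end SlopeLE

theorem Metric.IsConformal.le_leastLength {β : ℝ} {g : Metric β} (hg : g.IsConformal) {τ : ℂ → ℂ}
    {l : ℝ} (hl : ∀ p, ∃ h : ℂ → ℝ, SlopeLE h g.density ∧ l ≤ h (τ p) - h p) :
    l ≤ g.leastLength τ := by
  refine le_csInf ?_ ?_
  · obtain ⟨K, hK⟩ : ∃ K : NNReal, LipschitzWith K fun s : ℝ => s • τ 0 :=
      ⟨_, ((ContinuousLinearMap.id ℝ ℝ).smulRight (τ 0)).lipschitz⟩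
    exact ⟨_, fun s => s • τ 0, ⟨K, hK.lipschitzOnWith⟩, by simp, rfl⟩
  · rintro _ ⟨γ, ⟨C, hγ⟩, hτ, rfl⟩
    obtain ⟨h, hslope, hle⟩ := hl (γ 0)
    rw [hg.length_eq]
    rw [← hτ] at hle
    exact hle.trans (hslope.sub_le_integral (fun z => (g.density_pos z).le) g.continuous_density
      zero_le_one hγ)

/-! ### The round sphere in Mercator coordinates -/

/-- The point of the unit sphere with longitude `x` and Mercator latitude `y`, for `z = x + iy`. In
these coordinates the round metric has conformal factor `1 / cosh y`, and the antipodal map of the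
sphere is the glide reflection. -/
def mercator (z : ℂ) : EuclideanSpace ℝ (Fin 3) :=
  !₂[Real.cos z.re / Real.cosh z.im, Real.sin z.re / Real.cosh z.im,
    Real.sinh z.im / Real.cosh z.im]

theorem inner_mercator (z w : ℂ) : inner ℝ (mercator z) (mercator w) =
    1 - (Real.cosh (z.im - w.im) - Real.cos (z.re - w.re)) /
      (Real.cosh z.im * Real.cosh w.im) := by
  have hz := (Real.cosh_pos z.im).ne'
  have hw := (Real.cosh_pos w.im).ne'
  rw [Real.cosh_sub, Real.cos_sub]
  simp only [mercator, PiLp.inner_apply, RCLike.inner_apply, Real.ringHom_apply,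
    Fin.sum_univ_three, Fin.isValue, Matrix.cons_val_zero, Matrix.cons_val_one, Matrix.cons_val]
  field_simp
  ring

theorem norm_mercator (z : ℂ) : ‖mercator z‖ = 1 := by
  rw [norm_eq_sqrt_real_inner, inner_mercator]
  simp

theorem mercator_ne_zero (z : ℂ) : mercator z ≠ 0 :=
  norm_ne_zero_iff.1 ((norm_mercator z).trans_ne one_ne_zero)

theorem mercator_glide (z : ℂ) : mercator (glide z) = -mercator z := by
  ext i
  fin_cases i <;> simp [mercator, glide, neg_div]

theorem cosh_sub_cos_le {x y : ℝ} (h : x ^ 2 + y ^ 2 ≤ 1) :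
    Real.cosh y - Real.cos x ≤ (x ^ 2 + y ^ 2) / 2 * (1 + (x ^ 2 + y ^ 2) / 2) := by
  have hcosh : Real.cosh y ≤ 1 + y ^ 2 / 2 + (y ^ 2 / 2) ^ 2 := by
    have := (abs_le.1 (Real.abs_exp_sub_one_sub_id_le (x := y ^ 2 / 2)
      (by rw [abs_of_nonneg (by positivity)]; linarith [sq_nonneg x, sq_nonneg y]))).2
    linarith [Real.cosh_le_exp_half_sq y]
  calc Real.cosh y - Real.cos x ≤ (x ^ 2 + y ^ 2) / 2 + (y ^ 2) ^ 2 / 4 := by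
        linarith [Real.one_sub_sq_div_two_le_cos (x := x)]
    _ ≤ (x ^ 2 + y ^ 2) / 2 + (x ^ 2 + y ^ 2) ^ 2 / 4 := by
        gcongr
        exact le_add_of_nonneg_left (sq_nonneg x)
    _ = _ := by ring

section angle

open InnerProductGeometry

theorem one_sub_cos_angle_mercator_le {z w : ℂ} (h : ‖w - z‖ ≤ 1) :
    1 - Real.cos (angle (mercator z) (mercator w)) ≤
      1 / (Real.cosh z.im * Real.cosh w.im) * (‖w - z‖ ^ 2 / 2 * (1 + ‖w - z‖ ^ 2 / 2)) := by
  have hn : ‖w - z‖ ^ 2 = (z.re - w.re) ^ 2 + (z.im - w.im) ^ 2 := by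
    rw [norm_sub_rev, ← Complex.normSq_eq_norm_sq, Complex.normSq_apply, Complex.sub_re,
      Complex.sub_im, sq, sq]
  have hle := pow_le_one₀ (norm_nonneg _) h (n := 2)
  rw [hn] at hle ⊢
  rw [cos_angle, norm_mercator, norm_mercator, inner_mercator, mul_one, div_one, sub_sub_cancel,
    div_eq_mul_one_div, mul_comm]
  exact mul_le_mul_of_nonneg_left (cosh_sub_cos_le hle) (by positivity)

theorem eventually_angle_mercator_le {z : ℂ} {r : ℝ} (hr : 1 / Real.cosh z.im < r) :
    ∀ᶠ w in 𝓝 z, angle (mercator z) (mercator w) ≤ r * ‖w - z‖ := by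
  have hz := Real.cosh_pos z.im
  have hr0 : 0 < r := (one_div_pos.2 hz).trans hr
  have hnear : ∀ᶠ w in 𝓝 z, ‖w - z‖ < 1 :=
    ContinuousAt.eventually_lt (by fun_prop) continuousAt_const (by simp)
  have hsmall : ∀ᶠ w in 𝓝 z, r * ‖w - z‖ < 1 :=
    ContinuousAt.eventually_lt (by fun_prop) continuousAt_const (by simp)
  have hcoeff : ∀ᶠ w in 𝓝 z, 1 / (Real.cosh z.im * Real.cosh w.im) * (1 + ‖w - z‖ ^ 2 / 2) <
      r ^ 2 * (1 - 5 / 48 * (r * ‖w - z‖) ^ 2) := by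
    refine ContinuousAt.eventually_lt (ContinuousAt.mul (Continuous.continuousAt ?_) (by fun_prop))
      (by fun_prop) ?_
    · exact continuous_const.div (continuous_const.mul
        (Real.continuous_cosh.comp Complex.continuous_im)) fun w =>
          (mul_pos hz (Real.cosh_pos _)).ne'
    · simpa [← sq] using pow_lt_pow_left₀ hr (by positivity) two_ne_zero
  filter_upwards [hnear, hsmall, hcoeff] with w hw hrw hlt
  set d := ‖w - z‖
  have hd : 0 ≤ r * d := by positivity
  refine (Real.strictAntiOn_cos.le_iff_ge ⟨hd, ?_⟩ ⟨angle_nonneg _ _, angle_le_pi _ _⟩).1 ?_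
  · linarith [Real.pi_gt_three]
  · have hcos := (abs_le.1 (Real.cos_bound (x := r * d) (by rw [abs_of_nonneg hd]; exact hrw.le))).2
    rw [abs_of_nonneg hd] at hcos
    have hmul := mul_le_mul_of_nonneg_left hlt.le (by positivity : 0 ≤ d ^ 2 / 2)
    linarith [one_sub_cos_angle_mercator_le hw.le]

theorem abs_angle_sub_angle_le {V : Type*} [NormedAddCommGroup V] [InnerProductSpace ℝ V]
    (p x y : V) : |angle p y - angle p x| ≤ angle x y := by
  rw [abs_sub_le_iff, sub_le_iff_le_add', sub_le_iff_le_add']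
  exact ⟨angle_le_angle_add_angle p x y, angle_comm x y ▸ angle_le_angle_add_angle p y x⟩

theorem slopeLE_angle_mercator (p : EuclideanSpace ℝ (Fin 3)) :
    SlopeLE (fun z => angle p (mercator z)) fun z => 1 / Real.cosh z.im := by
  intro z ε hε
  filter_upwards [eventually_angle_mercator_le (lt_add_of_pos_right _ hε)] with w hw
  exact (abs_angle_sub_angle_le _ _ _).trans hw

end angle

/-! ### Folding the plane onto a strip -/

theorem latticeDist_add_int_mul (b v : ℝ) (n : ℤ) :
    latticeDist b (v + n * (2 * b)) = latticeDist b v := by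
  have h : Function.Periodic (latticeDist b) (2 * b) := fun v => by
    simp only [latticeDist, AddCircle.coe_add_period]
  exact h.int_mul n v

theorem latticeDist_eq_abs {b v : ℝ} (h : |v| ≤ b) : latticeDist b v = |v| := by
  rcases ((abs_nonneg v).trans h).eq_or_lt with rfl | hb
  · rw [abs_nonpos_iff.1 h, abs_zero, latticeDist, AddCircle.coe_zero, norm_zero]
  · refine (AddCircle.norm_coe_eq_abs_iff (2 * b) (by positivity)).2 ?_
    rw [abs_of_pos (by positivity : 0 < 2 * b)]
    linarith

theorem abs_latticeDist_sub_le (b v w : ℝ) : |latticeDist b v - latticeDist b w| ≤ |v - w| := by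
  refine (abs_norm_sub_norm_le _ _).trans ?_
  rw [← AddCircle.coe_sub]
  exact QuotientAddGroup.norm_mk_le_norm (S := AddSubgroup.zmultiples (2 * b)) (m := v - w)

theorem exists_eq_add_int_mul {b : ℝ} (hb : 0 < b) (v c : ℝ) :
    ∃ (w : ℝ) (n : ℤ), v = w + n * (2 * b) ∧ c ≤ w ∧ w ≤ c + 2 * b := by
  have hp : 0 < 2 * b := by positivity
  refine ⟨toIcoMod hp c v, toIcoDiv hp c v, ?_, left_le_toIcoMod hp c v,
    (toIcoMod_lt_right hp c v).le⟩
  rw [← zsmul_eq_mul, toIcoMod_add_toIcoDiv_zsmul]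

/-- The `2β`-periodic zigzag function equal to `y` on `|y| ≤ β / 2` and to `β - y` on
`β / 2 ≤ y ≤ 3 * β / 2`. -/
def fold (β y : ℝ) : ℝ := latticeDist β (y + β / 2) - β / 2

theorem fold_add_int_mul (β y : ℝ) (n : ℤ) : fold β (y + n * (2 * β)) = fold β y := by
  rw [fold, fold, add_right_comm, latticeDist_add_int_mul]

theorem fold_of_abs_le {β y : ℝ} (h : |y| ≤ β / 2) : fold β y = y := by
  have h' := abs_le.1 h
  have hnn : 0 ≤ y + β / 2 := by linarith
  rw [fold, latticeDist_eq_abs (by rw [abs_of_nonneg hnn]; linarith), abs_of_nonneg hnn,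
    add_sub_cancel_right]

theorem fold_of_abs_sub_le {β y : ℝ} (h : |y - β| ≤ β / 2) : fold β y = β - y := by
  have h' := abs_le.1 h
  have hnp : y + β / 2 - 2 * β ≤ 0 := by linarith
  have hper := latticeDist_add_int_mul β (y + β / 2 - 2 * β) 1
  rw [Int.cast_one, one_mul, sub_add_cancel] at hper
  rw [fold, hper, latticeDist_eq_abs (by rw [abs_of_nonpos hnp]; linarith), abs_of_nonpos hnp]
  ring

theorem exists_fold_cases {β : ℝ} (hβ : 0 < β) (y : ℝ) :
    ∃ (w : ℝ) (n : ℤ), y = w + n * (2 * β) ∧ (|w| ≤ β / 2 ∨ |w - β| ≤ β / 2) := by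
  obtain ⟨w, n, rfl, hlow, hhigh⟩ := exists_eq_add_int_mul hβ y (-(β / 2))
  refine ⟨w, n, rfl, (le_total w (β / 2)).imp (fun h => ?_) fun h => ?_⟩ <;>
    rw [abs_le] <;> constructor <;> linarith

theorem fold_neg {β : ℝ} (hβ : 0 < β) (y : ℝ) : fold β (-y) = -fold β y := by
  obtain ⟨w, n, rfl, h | h⟩ := exists_fold_cases hβ y
  · rw [fold_add_int_mul, fold_of_abs_le h,
      show -(w + n * (2 * β)) = -w + ((-n : ℤ) : ℝ) * (2 * β) by push_cast; ring,
      fold_add_int_mul, fold_of_abs_le (by rwa [abs_neg])]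
  · have hw : |2 * β - w - β| ≤ β / 2 := by
      rw [abs_sub_comm] at h
      rwa [two_mul, add_sub_right_comm, add_sub_cancel_right]
    rw [fold_add_int_mul, fold_of_abs_sub_le h,
      show -(w + n * (2 * β)) = (2 * β - w) + ((-n - 1 : ℤ) : ℝ) * (2 * β) by push_cast; ring,
      fold_add_int_mul, fold_of_abs_sub_le hw]
    ring

theorem abs_fold {β : ℝ} (hβ : 0 < β) (y : ℝ) : |fold β y| = latticeDist (β / 2) y := by
  obtain ⟨w, n, rfl, h | h⟩ := exists_fold_cases hβ y
  · rw [fold_add_int_mul, fold_of_abs_le h,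
      show w + n * (2 * β) = w + ((2 * n : ℤ) : ℝ) * (2 * (β / 2)) by push_cast; ring,
      latticeDist_add_int_mul, latticeDist_eq_abs h]
  · rw [fold_add_int_mul, fold_of_abs_sub_le h,
      show w + n * (2 * β) = (w - β) + ((2 * n + 1 : ℤ) : ℝ) * (2 * (β / 2)) by push_cast; ring,
      latticeDist_add_int_mul, latticeDist_eq_abs h, abs_sub_comm]

theorem abs_fold_sub_le (β v w : ℝ) : |fold β v - fold β w| ≤ |v - w| := by
  rw [fold, fold, sub_sub_sub_cancel_right, ← add_sub_add_right_eq_sub v w (β / 2)]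
  exact abs_latticeDist_sub_le β _ _

/-- The zigzag map of the plane onto the strip `|y| ≤ β / 2`. It intertwines the glide reflections
about all axes with the glide reflection of the strip. -/
def foldMap (β : ℝ) (z : ℂ) : ℂ := ⟨z.re, fold β z.im⟩

theorem lipschitzWith_foldMap (β : ℝ) : LipschitzWith 1 (foldMap β) := by
  refine LipschitzWith.of_dist_le_mul fun z w => ?_
  rw [NNReal.coe_one, one_mul, Complex.dist_eq_re_im, Complex.dist_eq_re_im]
  exact Real.sqrt_le_sqrt (add_le_add_right (sq_le_sq.2 (abs_fold_sub_le β z.im w.im)) _)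

theorem foldMap_glide {β : ℝ} (hβ : 0 < β) (z : ℂ) :
    foldMap β (glide z) = glide (foldMap β z) := by
  apply Complex.ext <;> simp [foldMap, glide, fold_neg hβ]

theorem foldMap_vert (β : ℝ) (z : ℂ) : foldMap β (vert β z) = foldMap β z := by
  have h := fold_add_int_mul β z.im 1
  rw [Int.cast_one, one_mul] at h
  apply Complex.ext <;> simp [foldMap, vert, h]

/-! ### The extremal metrics -/

/-- The conformal factor of the extremal metrics as a function of the height. -/
def extremalProfile (β a y : ℝ) : ℝ := capProfile a (latticeDist (β / 2) y)

theorem continuous_extremalProfile (β a : ℝ) : Continuous (extremalProfile β a) :=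
  (continuous_capProfile a).comp (latticeDist_continuous _)

theorem extremalProfile_pos (β a y : ℝ) : 0 < extremalProfile β a y := capProfile_pos _ _

theorem extremalProfile_neg (β a y : ℝ) : extremalProfile β a (-y) = extremalProfile β a y := by
  rw [extremalProfile, latticeDist_neg, extremalProfile]

theorem extremalProfile_periodic (β a : ℝ) : Function.Periodic (extremalProfile β a) β := by
  intro y
  have h := latticeDist_add_int_mul (β / 2) y 1
  rw [Int.cast_one, one_mul, mul_div_cancel₀ β two_ne_zero] at h
  rw [extremalProfile, h, extremalProfile]

theorem extremalProfile_add_two_mul (β a y : ℝ) :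
    extremalProfile β a (y + 2 * β) = extremalProfile β a y :=
  (extremalProfile_periodic β a).nat_mul 2 y

theorem extremalProfile_of_mem {β a y : ℝ} (hy : y ∈ Icc 0 (β / 2)) :
    extremalProfile β a y = capProfile a y := by
  rw [extremalProfile, latticeDist_eq_abs ((abs_of_nonneg hy.1).trans_le hy.2), abs_of_nonneg hy.1]

theorem one_div_cosh_fold_le {β a : ℝ} (hβ : 0 < β) (ha : 0 ≤ a) (y : ℝ) :
    1 / Real.cosh (fold β y) ≤ extremalProfile β a y := by
  have hd := latticeDist_nonneg (β / 2) y
  rw [extremalProfile, capProfile, ← Real.cosh_abs (fold β y), abs_fold hβ]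
  refine one_div_le_one_div_of_le (Real.cosh_pos _) (Real.cosh_le_cosh.2 ?_)
  rw [abs_of_nonneg hd, abs_of_nonneg (le_min hd ha)]
  exact min_le_left _ _

theorem one_div_cosh_le_extremalProfile {a : ℝ} (ha : 0 ≤ a) (β y : ℝ) :
    1 / Real.cosh a ≤ extremalProfile β a y := by
  refine one_div_le_one_div_of_le (Real.cosh_pos _) (Real.cosh_le_cosh.2 ?_)
  rw [abs_of_nonneg (le_min (latticeDist_nonneg (β / 2) y) ha), abs_of_nonneg ha]
  exact min_le_right _ _

theorem integral_comp_extremalProfile {F : ℝ → ℝ} (hF : Continuous F) {β : ℝ} (hβ : 0 ≤ β)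
    (a : ℝ) :
    ∫ y in (0 : ℝ)..β, F (extremalProfile β a y) =
      2 * ∫ y in (0 : ℝ)..(β / 2), F (capProfile a y) := by
  have hcap : ∫ y in (0 : ℝ)..(β / 2), F (extremalProfile β a y) =
      ∫ y in (0 : ℝ)..(β / 2), F (capProfile a y) := by
    refine intervalIntegral.integral_congr fun y hy => ?_
    rw [uIcc_of_le (by positivity)] at hy
    simp only [extremalProfile_of_mem hy]
  rw [← hcap]
  exact integral_eq_two_mul_half_of_symm (hF.comp (continuous_extremalProfile β a)) fun y => by
    rw [Function.comp_apply, (extremalProfile_periodic β a).sub_eq', extremalProfile_neg,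
      Function.comp_apply]

/-- The metric with conformal factor `extremalProfile β a`. It is extremal in its conformal class if
`a` is the cap radius: spherical for `a = β / 2`, flat-spherical for `cosh a = 2`. -/
def extremal (β a : ℝ) : Metric β where
  form z := extremalProfile β a z.im ^ 2 • (flat β).form z
  symm z v w := by
    simp only [LinearMap.smul_apply, (flat β).symm z v w]
  pos z v hv := by
    simp only [LinearMap.smul_apply, smul_eq_mul]
    exact mul_pos (pow_pos (extremalProfile_pos _ _ _) 2) ((flat β).pos z v hv)
  continuous v w := by
    simp only [LinearMap.smul_apply, smul_eq_mul]
    exact (((continuous_extremalProfile β a).comp Complex.continuous_im).pow 2).mul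
      ((flat β).continuous v w)
  glide_invariant z v w := by
    have : (glide z).im = -z.im := by simp [glide]
    simp only [LinearMap.smul_apply, (flat β).glide_invariant, this, extremalProfile_neg]
  vert_invariant z v w := by
    have : (vert β z).im = z.im + 2 * β := by simp [vert]
    simp only [LinearMap.smul_apply, (flat β).vert_invariant, this, extremalProfile_add_two_mul]

theorem extremal_form (β a : ℝ) (z v w : ℂ) :
    (extremal β a).form z v w = extremalProfile β a z.im ^ 2 * (v.re * w.re + v.im * w.im) := by
  simp [extremal, flat, warped, warpedForm_apply]

theorem extremal_isConformal (β a : ℝ) : (extremal β a).IsConformal :=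
  ⟨fun z => extremalProfile β a z.im ^ 2, fun _ => pow_pos (extremalProfile_pos _ _ _) 2,
    fun _ _ _ => rfl⟩

theorem extremal_density (β a : ℝ) :
    (extremal β a).density = fun z => extremalProfile β a z.im := by
  ext z
  rw [Metric.density, extremal_form]
  simp [Real.sqrt_sq (extremalProfile_pos β a z.im).le]

theorem extremal_vol {β : ℝ} (hβ : 0 ≤ β) (a : ℝ) :
    (extremal β a).vol = 4 * Real.pi * capArea a (β / 2) := by
  have hcont : Continuous fun y => extremalProfile β a y ^ 2 :=
    (continuous_extremalProfile β a).pow 2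
  rw [(extremal_isConformal β a).vol_eq hβ]
  simp only [extremal_density, intervalIntegral.integral_const, sub_zero, smul_eq_mul]
  rw [intervalIntegral.integral_const_mul, integral_two_mul_eq_integral_add hcont]
  simp only [extremalProfile_periodic β a _, ← two_mul]
  rw [intervalIntegral.integral_const_mul,
    integral_comp_extremalProfile (F := fun p => p ^ 2) (continuous_pow 2) hβ, capArea]
  ring

/-- The distance from the equator, as a function of the conformal height. -/
def extremalHeight (β a y : ℝ) : ℝ := ∫ s in (0 : ℝ)..y, extremalProfile β a s

theorem hasDerivAt_extremalHeight (β a y : ℝ) :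
    HasDerivAt (extremalHeight β a) (extremalProfile β a y) y :=
  (continuous_extremalProfile β a).integral_hasStrictDerivAt 0 y |>.hasDerivAt

theorem extremalHeight_add_int_mul {β : ℝ} (hβ : 0 ≤ β) (a y : ℝ) (n : ℤ) :
    extremalHeight β a (y + n * β) =
      extremalHeight β a y + n * (2 * capLength a (β / 2)) := by
  have hint (s t : ℝ) : IntervalIntegrable (extremalProfile β a) volume s t :=
    (continuous_extremalProfile β a).intervalIntegrable s t
  have hp := extremalProfile_periodic β a
  have hperiod : ∫ s in (0 : ℝ)..β, extremalProfile β a s = 2 * capLength a (β / 2) :=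
    integral_comp_extremalProfile (F := fun p => p) continuous_id hβ a
  rw [← sub_eq_iff_eq_add', extremalHeight, extremalHeight,
    intervalIntegral.integral_interval_sub_left (hint _ _) (hint _ _), ← zsmul_eq_mul,
    hp.intervalIntegral_add_zsmul_eq n y hint, hp.intervalIntegral_add_eq y 0, zero_add, hperiod,
    zsmul_eq_mul]

theorem four_mul_capLength_le_lV {β : ℝ} (hβ : 0 ≤ β) (a : ℝ) :
    4 * capLength a (β / 2) ≤ (extremal β a).lV := by
  refine (extremal_isConformal β a).le_leastLength fun p =>
    ⟨fun z => extremalHeight β a z.im, ?_, ?_⟩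
  · rw [extremal_density]
    refine (slopeLE_norm_fderiv fun z =>
      (hasDerivAt_extremalHeight β a z.im).comp_hasFDerivAt z Complex.imCLM.hasFDerivAt).mono
        fun z => ?_
    rw [norm_smul, Complex.imCLM_norm, mul_one, Real.norm_of_nonneg (extremalProfile_pos _ _ _).le]
  · have him : (vert β p).im = p.im + (2 : ℤ) * β := by simp [vert]
    beta_reduce
    rw [him, extremalHeight_add_int_mul hβ, add_sub_cancel_left, ← mul_assoc]
    norm_num

theorem two_pi_div_cosh_le_lH {a : ℝ} (ha : 0 ≤ a) (β : ℝ) :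
    2 * Real.pi / Real.cosh a ≤ (extremal β a).lH := by
  refine (extremal_isConformal β a).le_leastLength fun p =>
    ⟨fun z => 1 / Real.cosh a * z.re, ?_, ?_⟩
  · rw [extremal_density]
    refine (slopeLE_norm_fderiv fun z =>
      (Complex.reCLM.hasFDerivAt (x := z)).const_mul (1 / Real.cosh a)).mono fun z => ?_
    rw [norm_smul, Complex.reCLM_norm, mul_one,
      Real.norm_of_nonneg (one_div_pos.2 (Real.cosh_pos a)).le]
    exact one_div_cosh_le_extremalProfile ha β z.im
  · have hre : (glide (glide p)).re = p.re + 2 * Real.pi := by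
      simp [glide]
      ring
    rw [Function.comp_apply]
    beta_reduce
    rw [hre]
    exact le_of_eq (by ring)

open InnerProductGeometry in
theorem pi_le_leastLength {β a : ℝ} (hβ : 0 < β) (ha : 0 ≤ a) {τ : ℂ → ℂ}
    (hτ : ∀ p, foldMap β (τ p) = glide (foldMap β p)) :
    Real.pi ≤ (extremal β a).leastLength τ := by
  refine (extremal_isConformal β a).le_leastLength fun p =>
    ⟨fun z => angle (mercator (foldMap β p)) (mercator (foldMap β z)), ?_, ?_⟩
  · rw [extremal_density]
    exact ((slopeLE_angle_mercator (mercator (foldMap β p))).comp_lipschitzWith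
      (fun z => (one_div_pos.2 (Real.cosh_pos _)).le) (lipschitzWith_foldMap β)).mono
        fun z => one_div_cosh_fold_le hβ ha z.im
  · simp only [hτ]
    rw [mercator_glide, angle_self_neg_of_nonzero (mercator_ne_zero _),
      angle_self (mercator_ne_zero _), sub_zero]

theorem pi_le_LSigma {β a : ℝ} (hβ : 0 < β) (ha : 0 ≤ a) (hcosh : Real.cosh a ≤ 2) :
    Real.pi ≤ (extremal β a).LSigma := by
  refine le_min (le_min (pi_le_leastLength hβ ha (foldMap_glide hβ))
    (pi_le_leastLength hβ ha fun p => ?_)) (le_trans ?_ (two_pi_div_cosh_le_lH ha β))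
  · rw [Function.comp_apply, foldMap_vert, foldMap_glide hβ]
  · rw [le_div_iff₀ (Real.cosh_pos a), mul_comm]
    gcongr

theorem extremal_LSigma_mul_lV {β a : ℝ} (ha : IsCapRadius β a) :
    (extremal β a).LSigma * (extremal β a).lV =
      capLength a (β / 2) / capArea a (β / 2) * (extremal β a).vol := by
  have hβ : 0 < β := by linarith [ha.half_pos]
  have hb := capLength_pos a ha.half_pos
  have hI := capArea_pos a ha.half_pos
  have hLSigma := pi_le_LSigma hβ ha.pos.le ha.cosh_le_two
  refine le_antisymm ((extremal_isConformal β a).LSigma_mul_lV_le ha) ?_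
  calc capLength a (β / 2) / capArea a (β / 2) * (extremal β a).vol
      = Real.pi * (4 * capLength a (β / 2)) := by
        rw [extremal_vol hβ.le]
        field_simp
    _ ≤ _ := mul_le_mul hLSigma (four_mul_capLength_le_lV hβ.le a) (by positivity)
        (Real.pi_pos.le.trans hLSigma)

/-! ### Warped-product form of the extremal metrics -/

theorem contDiff_extremalHeight (β a : ℝ) : ContDiff ℝ 1 (extremalHeight β a) := by
  rw [contDiff_one_iff_deriv]
  refine ⟨fun y => (hasDerivAt_extremalHeight β a y).differentiableAt, ?_⟩
  rw [funext fun y => (hasDerivAt_extremalHeight β a y).deriv]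
  exact continuous_extremalProfile β a

theorem extremalHeight_strictMono (β a : ℝ) : StrictMono (extremalHeight β a) :=
  strictMono_of_deriv_pos fun y =>
    (hasDerivAt_extremalHeight β a y).deriv.symm ▸ extremalProfile_pos β a y

theorem extremalHeight_surjective {β : ℝ} (hβ : 0 < β) (a : ℝ) :
    Function.Surjective (extremalHeight β a) := by
  have hp := extremalProfile_periodic β a
  have hint := (continuous_extremalProfile β a).intervalIntegrable (μ := volume) 0 β
  exact (contDiff_extremalHeight β a).continuous.surjective
    (hp.tendsto_atTop_intervalIntegral_of_pos' hint (extremalProfile_pos β a) hβ)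
    (hp.tendsto_atBot_intervalIntegral_of_pos' hint (extremalProfile_pos β a) hβ)

theorem extremalHeight_neg (β a y : ℝ) : extremalHeight β a (-y) = -extremalHeight β a y := by
  have h := intervalIntegral.integral_comp_neg (a := 0) (b := y) (extremalProfile β a)
  simp only [extremalProfile_neg, neg_zero] at h
  rw [extremalHeight, intervalIntegral.integral_symm, ← h, extremalHeight]

theorem abs_extremalHeight (β a y : ℝ) : |extremalHeight β a y| = extremalHeight β a |y| := by
  have hzero : extremalHeight β a 0 = 0 := intervalIntegral.integral_same
  have hm := (extremalHeight_strictMono β a).monotone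
  rcases le_total 0 y with h | h
  · rw [abs_of_nonneg h, abs_of_nonneg (hzero ▸ hm h)]
  · rw [abs_of_nonpos h, abs_of_nonpos (hzero ▸ hm h), extremalHeight_neg]

theorem extremalHeight_eq_capLength {β y : ℝ} (hy : y ∈ Icc 0 (β / 2)) (a : ℝ) :
    extremalHeight β a y = capLength a y := by
  refine intervalIntegral.integral_congr fun s hs => ?_
  rw [uIcc_of_le hy.1] at hs
  exact extremalProfile_of_mem ⟨hs.1, hs.2.trans hy.2⟩

theorem extremalHeight_eq_arctan_sinh {β a y : ℝ} (haβ : a ≤ β / 2) (hy : y ∈ Icc 0 a) :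
    extremalHeight β a y = Real.arctan (Real.sinh y) := by
  have h := integral_one_div_cosh 0 y
  rw [Real.sinh_zero, Real.arctan_zero, sub_zero] at h
  rw [extremalHeight_eq_capLength ⟨hy.1, hy.2.trans haβ⟩, ← h]
  refine intervalIntegral.integral_congr fun s hs => ?_
  rw [uIcc_of_le hy.1] at hs
  simp only [capProfile, min_eq_left (hs.2.trans hy.2)]

theorem latticeDist_extremalHeight {β : ℝ} (hβ : 0 < β) (a y : ℝ) :
    latticeDist (capLength a (β / 2)) (extremalHeight β a y) =
      extremalHeight β a (latticeDist (β / 2) y) := by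
  obtain ⟨w, n, rfl, hlow, hhigh⟩ := exists_eq_add_int_mul (half_pos hβ) y (-(β / 2))
  have hw : |w| ≤ β / 2 := abs_le.2 ⟨hlow, by linarith⟩
  have hheight : |extremalHeight β a w| ≤ capLength a (β / 2) := by
    rw [abs_extremalHeight, ← extremalHeight_eq_capLength ⟨by positivity, le_rfl⟩]
    exact (extremalHeight_strictMono β a).monotone hw
  rw [latticeDist_add_int_mul, latticeDist_eq_abs hw, mul_div_cancel₀ β two_ne_zero,
    extremalHeight_add_int_mul hβ.le, latticeDist_add_int_mul, latticeDist_eq_abs hheight,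
    abs_extremalHeight]

theorem cos_min_latticeDist_extremalHeight {β a : ℝ} (ha : 0 < a) (haβ : a ≤ β / 2) (y : ℝ) :
    Real.cos (min (latticeDist (capLength a (β / 2)) (extremalHeight β a y))
      (Real.arctan (Real.sinh a))) = extremalProfile β a y := by
  have hd := latticeDist_nonneg (β / 2) y
  rw [latticeDist_extremalHeight (by linarith), ← extremalHeight_eq_arctan_sinh haβ ⟨ha.le, le_rfl⟩,
    ← (extremalHeight_strictMono β a).monotone.map_min,
    extremalHeight_eq_arctan_sinh haβ ⟨le_min hd ha.le, min_le_right _ _⟩, Real.cos_arctan,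
    sqrt_one_add_sinh_sq, extremalProfile, capProfile]

/-- The map `x + iy ↦ x + i e(y)`, which changes the vertical coordinate of the plane by `e`. -/
def verticalHomeomorph (e : ℝ ≃ₜ ℝ) : ℂ ≃ₜ ℂ :=
  Complex.equivRealProdCLM.toHomeomorph.trans
    (((Homeomorph.refl ℝ).prodCongr e).trans Complex.equivRealProdCLM.symm.toHomeomorph)

theorem verticalHomeomorph_apply (e : ℝ ≃ₜ ℝ) (z : ℂ) :
    verticalHomeomorph e z = ⟨z.re, e z.im⟩ := rfl

theorem verticalHomeomorph_symm (e : ℝ ≃ₜ ℝ) :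
    (verticalHomeomorph e).symm = verticalHomeomorph e.symm := rfl

theorem contDiff_verticalHomeomorph {n : WithTop ℕ∞} {e : ℝ ≃ₜ ℝ} (he : ContDiff ℝ n e) :
    ContDiff ℝ n (verticalHomeomorph e) :=
  Complex.equivRealProdCLM.symm.contDiff.comp
    (Complex.reCLM.contDiff.prodMk (he.comp Complex.imCLM.contDiff))

theorem fderiv_verticalHomeomorph {e : ℝ ≃ₜ ℝ} {e' : ℝ} {z : ℂ} (he : HasDerivAt e e' z.im)
    (v : ℂ) : fderiv ℝ (verticalHomeomorph e) z v = ⟨v.re, e' * v.im⟩ := by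
  have him : HasFDerivAt (fun z : ℂ => e z.im) _ z :=
    he.hasFDerivAt.comp z Complex.imCLM.hasFDerivAt
  have hmap : HasFDerivAt (verticalHomeomorph e) _ z :=
    Complex.equivRealProdCLM.symm.hasFDerivAt.comp z (Complex.reCLM.hasFDerivAt.prodMk him)
  rw [hmap.fderiv]
  apply Complex.ext <;> simp [mul_comm]

/-- `extremalHeight` as a homeomorphism of the line: the change of coordinate from the conformal
height to the distance from the equator. -/
def extremalHeightHomeomorph {β : ℝ} (hβ : 0 < β) (a : ℝ) : ℝ ≃ₜ ℝ :=
  ((extremalHeight_strictMono β a).orderIsoOfSurjective _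
    (extremalHeight_surjective hβ a)).toHomeomorph

theorem coe_extremalHeightHomeomorph {β : ℝ} (hβ : 0 < β) (a : ℝ) :
    ⇑(extremalHeightHomeomorph hβ a) = extremalHeight β a := rfl

theorem extremal_isometric_warped {β a b : ℝ} (ha : 0 < a) (haβ : a ≤ β / 2)
    (hb : b = capLength a (β / 2)) {f : ℝ → ℝ}
    (hf : ∀ v, f v = Real.cos (min (latticeDist b v) (Real.arctan (Real.sinh a))))
    (hc hpos heven) (hper : ∀ v, f (v + 2 * (2 * b)) = f v) :
    (extremal β a).Isometric (warped (2 * b) f hc hpos heven hper) := by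
  have hβ : 0 < β := by linarith
  set e := extremalHeightHomeomorph hβ a
  have he : ⇑e = extremalHeight β a := coe_extremalHeightHomeomorph hβ a
  have hd : ∀ y, HasDerivAt e (extremalProfile β a y) y := hasDerivAt_extremalHeight β a
  have hC : ContDiff ℝ 1 e := contDiff_extremalHeight β a
  refine ⟨verticalHomeomorph e, contDiff_verticalHomeomorph hC, ?_, fun z => ?_, fun z => ?_,
    fun z v w => ?_⟩
  · rw [verticalHomeomorph_symm]
    exact contDiff_verticalHomeomorph
      (e.contDiff_symm_deriv (fun y => (extremalProfile_pos β a y).ne') hd hC)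
  · apply Complex.ext <;> simp [verticalHomeomorph_apply, glide, he, extremalHeight_neg]
  · have h := extremalHeight_add_int_mul hβ.le a z.im 2
    rw [← hb, Int.cast_ofNat] at h
    apply Complex.ext <;> simp [verticalHomeomorph_apply, vert, he, h]
  · rw [fderiv_verticalHomeomorph (hd z.im), fderiv_verticalHomeomorph (hd z.im), extremal_form,
      verticalHomeomorph_apply, he]
    simp only [warped, warpedForm_apply]
    rw [hf, hb, cos_min_latticeDist_extremalHeight ha haβ]
    ring

/-! ### The two ranges of conformal types -/

theorem tan_eq_one_sub_cos_two_mul_div_sin_two_mul (x : ℝ) :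
    Real.tan x = (1 - Real.cos (2 * x)) / Real.sin (2 * x) := by
  rw [Real.cos_two_mul', Real.sin_two_mul, Real.tan_eq_sin_div_cos]
  rcases eq_or_ne (Real.sin x) 0 with hs | hs
  · simp only [hs, mul_zero, zero_mul, div_zero, zero_div]
  · rw [show 1 - (Real.cos x ^ 2 - Real.sin x ^ 2) = 2 * Real.sin x * Real.sin x by
      linear_combination -Real.sin_sq_add_cos_sq x, mul_div_mul_left _ _ (by positivity)]

theorem log_tan_pi_div_four_add_arctan_sinh (y : ℝ) :
    Real.log (Real.tan (Real.pi / 4 + Real.arctan (Real.sinh y) / 2)) = y := by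
  have hcosh := (Real.cosh_pos y).ne'
  have htan : Real.tan (Real.pi / 4 + Real.arctan (Real.sinh y) / 2) = Real.exp y := by
    rw [tan_eq_one_sub_cos_two_mul_div_sin_two_mul,
      show 2 * (Real.pi / 4 + Real.arctan (Real.sinh y) / 2) =
        Real.arctan (Real.sinh y) + Real.pi / 2 by ring,
      Real.cos_add_pi_div_two, Real.sin_add_pi_div_two, Real.sin_arctan, Real.cos_arctan,
      sqrt_one_add_sinh_sq, ← Real.cosh_add_sinh]
    field_simp
    ring
  rw [htan, Real.log_exp]

theorem cosh_log_two_add_sqrt_three : Real.cosh (Real.log (2 + √3)) = 2 := by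
  have hsq : √3 ^ 2 = 3 := Real.sq_sqrt (by positivity)
  rw [Real.cosh_log (by positivity)]
  field_simp
  linarith

theorem sinh_log_two_add_sqrt_three : Real.sinh (Real.log (2 + √3)) = √3 := by
  have hsq : √3 ^ 2 = 3 := Real.sq_sqrt (by positivity)
  rw [Real.sinh_log (by positivity)]
  field_simp
  linarith

theorem log_two_add_sqrt_three_pos : 0 < Real.log (2 + √3) :=
  Real.log_pos (by linarith [Real.sqrt_nonneg 3])

theorem isCapRadius_half {β : ℝ} (hβ : 0 < β) (hle : β ≤ 2 * Real.log (2 + √3)) :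
    IsCapRadius β (β / 2) where
  pos := half_pos hβ
  le_half := le_rfl
  cosh_le_two := by
    refine le_of_le_of_eq (Real.cosh_le_cosh.2 ?_) cosh_log_two_add_sqrt_three
    rw [abs_of_pos (half_pos hβ), abs_of_pos log_two_add_sqrt_three_pos]
    linarith
  eq_half_or := Or.inl rfl

theorem isCapRadius_log {β : ℝ} (hle : 2 * Real.log (2 + √3) ≤ β) :
    IsCapRadius β (Real.log (2 + √3)) where
  pos := log_two_add_sqrt_three_pos
  le_half := by linarith
  cosh_le_two := cosh_log_two_add_sqrt_three.le
  eq_half_or := Or.inr cosh_log_two_add_sqrt_three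

theorem exp_sub_one_div_exp_add_one (x : ℝ) :
    (Real.exp x - 1) / (Real.exp x + 1) = Real.sinh (x / 2) / Real.cosh (x / 2) := by
  have hexp : Real.exp x = Real.exp (x / 2) * Real.exp (x / 2) := by
    rw [← Real.exp_add, add_halves]
  rw [Real.sinh_eq, Real.cosh_eq, Real.exp_neg, hexp]
  field_simp

theorem capLength_half {β : ℝ} (hβ : 0 ≤ β) :
    capLength (β / 2) (β / 2) = Real.arctan (Real.sinh (β / 2)) := by
  rw [capLength_eq (by positivity) le_rfl, sub_self, zero_div, add_zero]

theorem sphericalConst_eq {β : ℝ} (hβ : 0 ≤ β) :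
    sphericalConst β = capLength (β / 2) (β / 2) / capArea (β / 2) (β / 2) := by
  rw [sphericalConst, exp_sub_one_div_exp_add_one, capLength_half hβ,
    capArea_eq (by positivity) le_rfl, sub_self, zero_div, add_zero, Real.arctan_eq_arcsin,
    sqrt_one_add_sinh_sq]

theorem capLength_log {β : ℝ} (hle : 2 * Real.log (2 + √3) ≤ β) :
    capLength (Real.log (2 + √3)) (β / 2) = Real.pi / 3 + (β / 2 - Real.log (2 + √3)) / 2 := by
  rw [capLength_eq log_two_add_sqrt_three_pos.le (by linarith), sinh_log_two_add_sqrt_three,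
    cosh_log_two_add_sqrt_three, Real.arctan_sqrt_three]

theorem flatSphericalConst_eq {β : ℝ} (hle : 2 * Real.log (2 + √3) ≤ β) :
    flatSphericalConst β =
      capLength (Real.log (2 + √3)) (β / 2) / capArea (Real.log (2 + √3)) (β / 2) := by
  rw [flatSphericalConst, capLength_log hle,
    capArea_eq log_two_add_sqrt_three_pos.le (by linarith), sinh_log_two_add_sqrt_three,
    cosh_log_two_add_sqrt_three,
    show Real.pi / 3 + (β / 2 - Real.log (2 + √3)) / 2 =
      1 / 12 * (3 * β + 4 * Real.pi - 6 * Real.log (2 + √3)) by ring,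
    show √3 / 2 + (β / 2 - Real.log (2 + √3)) / 2 ^ 2 =
      1 / 8 * (4 * √3 + β - 2 * Real.log (2 + √3)) by ring, mul_div_mul_comm]
  norm_num

theorem extremal_isometric_spherical {β b : ℝ} (hβ : 0 < β)
    (hb : b = Real.arctan (Real.sinh (β / 2))) (h0 : 0 < b) (h1 : b < Real.pi / 2) :
    (extremal β (β / 2)).Isometric (spherical b h0 h1) := by
  refine extremal_isometric_warped (half_pos hβ) le_rfl (hb.trans (capLength_half hβ.le).symm)
    (fun v => ?_) _ _ _ _
  rw [← hb, min_eq_left (latticeDist_le h0 v)]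

theorem extremal_isometric_flatSpherical {β b : ℝ} (hle : 2 * Real.log (2 + √3) ≤ β)
    (hb : b = capLength (Real.log (2 + √3)) (β / 2)) :
    (extremal β (Real.log (2 + √3))).Isometric (flatSpherical b) := by
  refine extremal_isometric_warped log_two_add_sqrt_three_pos (by linarith) hb (fun v => ?_) _ _ _ _
  rw [flatSphericalProfile_eq, sinh_log_two_add_sqrt_three, Real.arctan_sqrt_three]

end

end KleinBottle

theorem theorem2 (β : ℝ) (hβ : 0 < β) :
    (β ≤ 2 * Real.log (2 + Real.sqrt 3) →
      (∀ g : KleinBottle.Metric β, g.IsConformal →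
        g.LSigma * g.lV ≤ KleinBottle.sphericalConst β * g.vol) ∧
      ∃ (b : ℝ) (h0 : 0 < b) (h1 : b < Real.pi / 2),
        β = 2 * Real.log (Real.tan (Real.pi / 4 + b / 2)) ∧
        ∃ g : KleinBottle.Metric β, g.IsConformal ∧
          g.Isometric (KleinBottle.spherical b h0 h1) ∧
          g.LSigma * g.lV = KleinBottle.sphericalConst β * g.vol) ∧
    (2 * Real.log (2 + Real.sqrt 3) < β →
      (∀ g : KleinBottle.Metric β, g.IsConformal →
        g.LSigma * g.lV ≤ KleinBottle.flatSphericalConst β * g.vol) ∧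
      ∃ b : ℝ, Real.pi / 3 < b ∧
        β = 2 * Real.log (2 + Real.sqrt 3) + 4 * (b - Real.pi / 3) ∧
        ∃ g : KleinBottle.Metric β, g.IsConformal ∧
          g.Isometric (KleinBottle.flatSpherical b) ∧
          g.LSigma * g.lV = KleinBottle.flatSphericalConst β * g.vol) := by
  open KleinBottle in
  refine ⟨fun hle => ?_, fun hlt => ?_⟩
  · have ha := isCapRadius_half hβ hle
    have hb : 0 < Real.arctan (Real.sinh (β / 2)) :=
      Real.arctan_pos.2 (Real.sinh_pos_iff.2 (half_pos hβ))
    rw [sphericalConst_eq hβ.le]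
    refine ⟨fun g hg => hg.LSigma_mul_lV_le ha, _, hb, Real.arctan_lt_pi_div_two _, ?_,
      extremal β (β / 2), extremal_isConformal _ _,
      extremal_isometric_spherical hβ rfl hb _, extremal_LSigma_mul_lV ha⟩
    rw [log_tan_pi_div_four_add_arctan_sinh, mul_div_cancel₀ β two_ne_zero]
  · have ha := isCapRadius_log hlt.le
    have hb := capLength_log hlt.le
    rw [flatSphericalConst_eq hlt.le]
    exact ⟨fun g hg => hg.LSigma_mul_lV_le ha, _, by linarith, by linarith,
      extremal β (Real.log (2 + √3)), extremal_isConformal _ _,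
      extremal_isometric_flatSpherical hlt.le rfl, extremal_LSigma_mul_lV ha⟩
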